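/- Let $E$ be a finite-dimensional real vector space with a negative definite scalar product $\langle\cdot,\cdot\rangle$ and $\dim E = n-1\equiv 4 \pmod 8$. Let $b$ be a non-degenerate symmetric bilinear form on $E$, and define $B\in\mathrm{End}_{\mathbb R}(E)$ by $b(x,y)=-\langle Bx,y\rangle$. For $x\in E$ put $x^\flat=\langle x,\cdot\rangle\in E^*$. Let $\mathfrak{heis}_b=E^*+E+\mathbb{R}p$ be the Lie algebra whose only non-trivial brackets are $[x^\flat,y]=b(x,y)\,p$ for $x,y\in E$. Let $\mathrm{Cl}(E)$ be the Clifford algebra with relation $v^2=-\langle v,v\rangle$, let $S_0$ be an irreducible real $\mathrm{Cl}(E)$-module, and let $\omega=e_1\cdots e_{n-1}$ be the volume form of an orthonormal basis of $E$ (i.e. $\langle e_i,e_j\rangle=-\delta_{ij}$). Let $\mathcal C^\circ$ be the even Schur algebra, the algebra of real endomorphisms of $S_0$ commuting with Clifford multiplication. Let $\mathfrak m=E\oplus\mathbb Rp\oplus\mathbb Rq$ be the Minkowski space extending $E$, with $\langle p,E\rangle=\langle q,E\rangle=\langle p,p\rangle=\langle q,q\rangle=0$ and $\langle p,q\rangle=1$.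 Let $S=S_-\oplus S_+$ with $S_\pm= S_0$ be its spin module, on which $x+sp+tq$ (with $x\in E$ and $s,t\in\mathbb R$) acts by $\begin{pmatrix}-x&2\sqrt2\,s\\-t/\sqrt2&x\end{pmatrix}$. A *spin representation* of $\mathfrak{heis}_b$ is a Lie algebra representation $\rho:\mathfrak{heis}_b\to\mathfrak{gl}_{\mathbb R}(S)$ such that $\rho(x^\flat)$ is the action of $p\wedge Bx=\tfrac14[p,Bx]\in\mathrm{Cl}(\mathfrak m)$ for all $x\in E$, that is, $\rho(x^\flat)=\begin{pmatrix}0&\sqrt2\,Bx\\0&0\end{pmatrix}$. It has *non-zero charge* if $\rho(p)\neq0$. For $\rho_{11},\rho_{22},\rho_{12}\in\mathrm{Hom}_{\mathbb R}(E,\mathrm{End}_{\mathbb R}(S_0))$, the map $\rho_{12}$ is called $(\rho_{11},\rho_{22})$-*suitable* if $\rho_{11}(x)\rho_{12}(y)-\rho_{12}(y)\rho_{22}(x)$ is symmetric in $x,y\in E$. **Theorem.** The even Schur algebra $\mathcal C^\circ$ is isomorphic to $\mathbb H$ as a real algebra. Fix any isomorphism $\mathcal C^\circ\cong\mathbb H$.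 The spin representations of $\mathfrak{heis}_b$ of non-zero charge are exactly the linear maps $\rho$ given by $\rho(x^\flat)=\begin{pmatrix}0&\sqrt2\,Bx\\0&0\end{pmatrix}$ and $$\rho(p)=\sqrt2\begin{pmatrix}0&h_1(\mathrm{Id}\pm\omega)\\0&0\end{pmatrix},\qquad \rho(x)=\begin{pmatrix}\rho_{11}(x)&\rho_{12}(x)\\0&\rho_{22}(x)\end{pmatrix}\quad(x\in E),$$ $$2\rho_{11}(x)=h_3(x)\,\mathrm{Id}-h_1x\pm h_1x\,\omega-h_4(x)\,\omega,\qquad 2\rho_{22}(x)=h_3(x)\,\mathrm{Id}+h_1x\pm h_1x\,\omega+h_4(x)\,\omega,$$ where the sign $\pm$ is the same throughout, $h_1\in\mathbb H$, $h_3,h_4\in\mathrm{Hom}_{\mathbb R}(E,\mathbb H)$, the map $\rho_{12}\in\mathrm{Hom}_{\mathbb R}(E,\mathrm{End}_{\mathbb R}(S_0))$ is $(\rho_{11},\rho_{22})$-suitable, and one of the following holds: 1. $\operatorname{Re}h_1\ne0$, the linear map $\operatorname{Im}h_3:E\to\operatorname{Im}\mathbb H$ satisfies $\dim\bigl(E/\operatorname{Ker}(\operatorname{Im}h_3)\bigr)\le1$,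 and $h_4(x)=\mp\dfrac{\operatorname{Im}h_1\times\operatorname{Im}h_3(x)}{\operatorname{Re}h_1}$ for all $x\in E$ (upper sign for $+$, lower sign for $-$); 2. $\operatorname{Re}h_1=0$, $\operatorname{Im}h_1\neq0$, and there are linear forms $h_3^{\mathbb R},h_3^{\mathbb C},\mu:E\to\mathbb R$ and a unit imaginary quaternion $\nu\perp\operatorname{Im}h_1$ with $h_3(x)=h_3^{\mathbb R}(x)+h_3^{\mathbb C}(x)\frac{\operatorname{Im}h_1}{|\operatorname{Im}h_1|}$ and $h_4(x)=\mu(x)\,\nu$ for all $x\in E$, where $\operatorname{Ker}\mu=\operatorname{Ker}h_3^{\mathbb C}$ if $h_3^{\mathbb C}\ne0$ and $\mu\neq0$. -/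

import Mathlib

open scoped Quaternion

namespace CahenWallach

noncomputable section

section Euclidean

variable (E : Type*) [NormedAddCommGroup E] [InnerProductSpace ℝ E]

/-- The restriction to `E` of the Lorentzian scalar product of signature `(+, -)`. It is negative
definite, i.e. minus the Euclidean inner product of `E`. -/
def metric : LinearMap.BilinForm ℝ E := -(innerₗ E)

/-- The quadratic form `v ↦ -⟨v, v⟩`, so that the Clifford relation is `v * v = -⟨v, v⟩`. -/
def cliffordForm : QuadraticForm ℝ E := -(metric E).toQuadraticMap

/-- The Clifford algebra of `E = ℝ^{0, n - 1}`, with relation `v * v + ⟨v, v⟩ = 0`. -/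
abbrev Cl : Type _ := CliffordAlgebra (cliffordForm E)

/-- The Minkowski scalar product on `𝔪 = E ⊕ ℝ p ⊕ ℝ q`; the triple `(x, s, t)` stands for
`x + s p + t q`, where `p`, `q` are null, orthogonal to `E`, and `⟨p, q⟩ = 1`. -/
def minkowski : LinearMap.BilinForm ℝ (E × ℝ × ℝ) :=
  LinearMap.mk₂ ℝ (fun v w => metric E v.1 w.1 + (v.2.1 * w.2.2 + v.2.2 * w.2.1))
    (by intros; simp; ring) (by intros; simp; ring) (by intros; simp; ring)
    (by intros; simp; ring)

/-- The quadratic form `v ↦ -⟨v, v⟩` on the Minkowski space. -/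
def minkowskiForm : QuadraticForm ℝ (E × ℝ × ℝ) := -(minkowski E).toQuadraticMap

variable {E}

lemma cliffordForm_apply (x : E) : cliffordForm E x = inner ℝ x x := by
  simp [cliffordForm, metric, innerₗ_apply_apply]

lemma minkowskiForm_apply (v : E × ℝ × ℝ) :
    minkowskiForm E v = inner ℝ v.1 v.1 - 2 * (v.2.1 * v.2.2) := by
  simp [minkowskiForm, minkowski, metric, innerₗ_apply_apply]
  ring

/-- The element `v ∧ w` of `𝔰𝔬(𝔪)`, embedded in the Clifford algebra of `𝔪` as `[v, w] / 4`. -/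
def wedge (v w : E × ℝ × ℝ) : CliffordAlgebra (minkowskiForm E) :=
  (1 / 4 : ℝ) •
    ⁅CliffordAlgebra.ι (minkowskiForm E) v, CliffordAlgebra.ι (minkowskiForm E) w⁆

/-- The volume form `e₁ ⋯ e_m` of an orthonormal basis. -/
def volumeForm {m : ℕ} (e : OrthonormalBasis (Fin m) ℝ E) : Cl E :=
  (List.ofFn fun i => CliffordAlgebra.ι (cliffordForm E) (e i)).prod

variable (E) in
lemma metric_nondegenerate : (metric E).Nondegenerate := by
  constructor <;>
  · intro x hx
    have h := hx x
    simpa [metric, innerₗ_apply_apply] using h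

section Musical

variable [FiniteDimensional ℝ E]

variable (E) in
/-- The musical isomorphism `e ↦ e^♭ = ⟨e, ·⟩`. -/
def flat : E ≃ₗ[ℝ] Module.Dual ℝ E := (metric E).toDual (metric_nondegenerate E)

lemma flat_apply (x y : E) : flat E x y = metric E x y := rfl

/-- The endomorphism `B` of `E` with `b(x, y) = -⟨B x, y⟩`. -/
def endB (b : LinearMap.BilinForm ℝ E) : E →ₗ[ℝ] E := -((flat E).symm.toLinearMap ∘ₗ b)

lemma endB_spec (b : LinearMap.BilinForm ℝ E) (x y : E) : b x y = -metric E (endB b x) y := by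
  have h : flat E ((flat E).symm (b x)) y = b x y := by simp
  rw [flat_apply] at h
  simp [endB, h]

end Musical

/-! ### The Heisenberg algebra -/

/-- The vector space `𝔥𝔢𝔦𝔰_b = E^* + E + ℝ p`. -/
def Heis (_b : LinearMap.BilinForm ℝ E) : Type _ := Module.Dual ℝ E × E × ℝ

namespace Heis

variable (b : LinearMap.BilinForm ℝ E)

instance : AddCommGroup (Heis b) := inferInstanceAs (AddCommGroup (Module.Dual ℝ E × E × ℝ))

instance : Module ℝ (Heis b) := inferInstanceAs (Module ℝ (Module.Dual ℝ E × E × ℝ))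

/-- The inclusion of `E^*`. -/
def ofDual : Module.Dual ℝ E →ₗ[ℝ] Heis b := LinearMap.inl ℝ (Module.Dual ℝ E) (E × ℝ)

/-- The inclusion of `E`. -/
def ofVec : E →ₗ[ℝ] Heis b :=
  LinearMap.inr ℝ (Module.Dual ℝ E) (E × ℝ) ∘ₗ LinearMap.inl ℝ E ℝ

/-- The central element `p`. -/
def p : Heis b := ((0, 0, 1) : Module.Dual ℝ E × E × ℝ)

/-- The component in `E^*`. -/
def dualPart : Heis b →ₗ[ℝ] Module.Dual ℝ E := LinearMap.fst ℝ (Module.Dual ℝ E) (E × ℝ)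

/-- The component in `E`. -/
def vecPart : Heis b →ₗ[ℝ] E :=
  LinearMap.fst ℝ E ℝ ∘ₗ LinearMap.snd ℝ (Module.Dual ℝ E) (E × ℝ)

lemma dualPart_p : dualPart b (p b) = 0 := rfl

lemma vecPart_p : vecPart b (p b) = 0 := rfl

variable [FiniteDimensional ℝ E]

/-- The brackets of the Heisenberg algebra: `[e^♭, f] = b(e, f) p`, where `E^*` and `E` are
abelian and `p` is central. -/
instance : Bracket (Heis b) (Heis b) where
  bracket u v := (b ((flat E).symm (dualPart b u)) (vecPart b v)
    - b ((flat E).symm (dualPart b v)) (vecPart b u)) • p b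

lemma bracket_def (u v : Heis b) :
    ⁅u, v⁆ = (b ((flat E).symm (dualPart b u)) (vecPart b v)
      - b ((flat E).symm (dualPart b v)) (vecPart b u)) • p b := rfl

instance : LieRing (Heis b) where
  add_lie u v w := by
    simp only [bracket_def, map_add, LinearMap.add_apply]
    module
  lie_add u v w := by
    simp only [bracket_def, map_add, LinearMap.add_apply]
    module
  lie_self u := by simp [bracket_def]
  leibniz_lie u v w := by simp [bracket_def, dualPart_p, vecPart_p]

instance : LieAlgebra ℝ (Heis b) where
  lie_smul c u v := by
    simp only [bracket_def, map_smul, LinearMap.smul_apply, smul_eq_mul]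
    module

lemma flat_lie_vec (x y : E) : ⁅ofDual b (flat E x), ofVec b y⁆ = b x y • p b := by
  have h1 : dualPart b (ofDual b (flat E x)) = flat E x := rfl
  have h2 : vecPart b (ofDual b (flat E x)) = 0 := rfl
  have h3 : dualPart b (ofVec b y) = 0 := rfl
  have h4 : vecPart b (ofVec b y) = y := rfl
  simp [bracket_def, h1, h2, h3, h4]

end Heis

end Euclidean

section Spinors

variable {E : Type*} [NormedAddCommGroup E] [InnerProductSpace ℝ E]
variable (S : Type*) [AddCommGroup S] [Module ℝ S] [Module (Cl E) S] [IsScalarTower ℝ (Cl E) S]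

/-- The action of the Clifford algebra of `E` on a module `S`. -/
def act : Cl E →ₐ[ℝ] Module.End ℝ S := Algebra.lsmul ℝ ℝ S

/-- Clifford multiplication by vectors of `E` on `S`. -/
def cmul : E →ₗ[ℝ] Module.End ℝ S :=
  (act S).toLinearMap ∘ₗ CliffordAlgebra.ι (cliffordForm E)

lemma cmul_cmul (x : E) (s : S) : cmul S x (cmul S x s) = (inner ℝ x x : ℝ) • s := by
  have h : cmul S x * cmul S x = algebraMap ℝ (Module.End ℝ S) (inner ℝ x x) := by
    have := congrArg (act S) (CliffordAlgebra.ι_sq_scalar (cliffordForm E) x)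
    rw [map_mul, cliffordForm_apply] at this
    simpa [cmul] using this
  exact congrArg (fun f : Module.End ℝ S => f s) h

variable (E) in
/-- The even Schur algebra: the real algebra of the endomorphisms of `S` that commute with Clifford
multiplication by vectors (hence with `𝔰𝔬(E)` and with the whole Clifford algebra). -/
def evenSchur : Subalgebra ℝ (Module.End ℝ S) :=
  Subalgebra.centralizer ℝ (Set.range (cmul S : E →ₗ[ℝ] Module.End ℝ S))

variable {S}

/-- The endomorphism of `S_- ⊕ S_+ = S ⊕ S` with block matrix `(a, b; c, d)`. -/
def block (a b c d : Module.End ℝ S) : Module.End ℝ (S × S) :=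
  (a.coprod b).prod (c.coprod d)

lemma block_apply (a b c d : Module.End ℝ S) (s : S × S) :
    block a b c d s = (a s.1 + b s.2, c s.1 + d s.2) := rfl

variable (S)

/-- The action of the vectors of the Minkowski space on `S_- ⊕ S_+`: the vector `x + s p + t q`
acts by the block matrix `(-x, 2 √2 s; -t / √2, x)`. -/
def vecAct : E × ℝ × ℝ →ₗ[ℝ] Module.End ℝ (S × S) where
  toFun v := block (-cmul S v.1) ((2 * √2 * v.2.1) • 1) ((-(1 / √2) * v.2.2) • 1) (cmul S v.1)
  map_add' v w := by
    ext s <;> simp [block, mul_add, add_smul]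
    abel
  map_smul' c v := by
    ext s <;> simp [block, smul_smul] <;> congr 1 <;> ring

lemma vecAct_apply (v : E × ℝ × ℝ) (s : S × S) :
    vecAct S v s = (-cmul S v.1 s.1 + (2 * √2 * v.2.1) • s.2,
      (-(1 / √2) * v.2.2) • s.1 + cmul S v.1 s.2) := rfl

/-- The spin representation of the Clifford algebra of the Minkowski space `𝔪`, on the spin module
`S_- ⊕ S_+` obtained from the `Cl(E)`-module `S`. -/
def spinRep : CliffordAlgebra (minkowskiForm E) →ₐ[ℝ] Module.End ℝ (S × S) :=
  CliffordAlgebra.lift (minkowskiForm E) ⟨vecAct S, fun v => by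
    have h2 : √2 ≠ 0 := by positivity
    refine LinearMap.ext fun s => ?_
    rw [minkowskiForm_apply, Module.algebraMap_end_apply, Module.End.mul_apply]
    simp only [vecAct_apply, map_add, map_neg, map_smul, cmul_cmul, Prod.smul_def]
    refine Prod.ext ?_ ?_ <;>
    · dsimp only
      match_scalars <;> field_simp <;> ring⟩

variable {S}

variable [FiniteDimensional ℝ E]

/-- A linear map `ρ : 𝔥𝔢𝔦𝔰_b → 𝔤𝔩(S_- ⊕ S_+)` is a spin representation if it is a representation
of the Lie algebra `𝔥𝔢𝔦𝔰_b` whose restriction to `E^*` is the spin representation composed with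
the isotropy embedding `e^♭ ↦ p ∧ B e` into `𝔰𝔬(𝔪)`. -/
structure IsSpinRepresentation (b : LinearMap.BilinForm ℝ E)
    (ρ : Heis b →ₗ[ℝ] Module.End ℝ (S × S)) : Prop where
  map_lie : ∀ u v : Heis b, ρ ⁅u, v⁆ = ⁅ρ u, ρ v⁆
  spin : ∀ x : E, ρ (Heis.ofDual b (flat E x)) =
    spinRep (E := E) S (wedge ((0, 1, 0) : E × ℝ × ℝ) (endB b x, 0, 0))

/-! ### The data of a representation of non-zero charge -/

/-- The linear map `h ↦ Im h` on the quaternions. -/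
def imₗ : ℍ[ℝ] →ₗ[ℝ] ℍ[ℝ] where
  toFun h := h.im
  map_add' _ _ := by simp
  map_smul' _ _ := by simp

/-- The cross product of (imaginary parts of) quaternions, for the identification of the imaginary
quaternions with `ℝ³` by the basis `i, j, k`. -/
def cross (u v : ℍ[ℝ]) : ℍ[ℝ] :=
  ⟨0, u.imJ * v.imK - u.imK * v.imJ, u.imK * v.imI - u.imI * v.imK,
    u.imI * v.imJ - u.imJ * v.imI⟩

/-- A map `ρ₁₂` is `(ρ₁₁, ρ₂₂)`-suitable if `ρ₁₁(x) ρ₁₂(y) - ρ₁₂(y) ρ₂₂(x)` is symmetric in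
`x` and `y`. -/
def IsSuitable (ρ₁₁ ρ₂₂ ρ₁₂ : E →ₗ[ℝ] Module.End ℝ S) : Prop :=
  ∀ x y : E, ρ₁₁ x * ρ₁₂ y - ρ₁₂ y * ρ₂₂ x = ρ₁₁ y * ρ₁₂ x - ρ₁₂ x * ρ₂₂ y

/-- The endomorphism of `S` that corresponds to a quaternion under an identification of the
quaternions with the even Schur algebra. -/
def quat (φ : ℍ[ℝ] ≃ₐ[ℝ] evenSchur E S) : ℍ[ℝ] →ₐ[ℝ] Module.End ℝ S :=
  (evenSchur E S).val.comp φ.toAlgHom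

/-- `ρ₁₁(x) = (h₃(x) - h₁ x + ε h₁ x ω - h₄(x) ω) / 2`. -/
def rho₁₁ (φ : ℍ[ℝ] ≃ₐ[ℝ] evenSchur E S) (ω : Module.End ℝ S) (ε : ℝ) (h₁ : ℍ[ℝ])
    (h₃ h₄ : E →ₗ[ℝ] ℍ[ℝ]) : E →ₗ[ℝ] Module.End ℝ S where
  toFun x := (1 / 2 : ℝ) • (quat φ (h₃ x) - quat φ h₁ * cmul S x
    + ε • (quat φ h₁ * cmul S x * ω) - quat φ (h₄ x) * ω)
  map_add' x y := by
    simp only [map_add, mul_add, add_mul]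
    module
  map_smul' c x := by
    simp only [map_smul, mul_smul_comm, smul_mul_assoc, RingHom.id_apply]
    module

/-- `ρ₂₂(x) = (h₃(x) + h₁ x + ε h₁ x ω + h₄(x) ω) / 2`. -/
def rho₂₂ (φ : ℍ[ℝ] ≃ₐ[ℝ] evenSchur E S) (ω : Module.End ℝ S) (ε : ℝ) (h₁ : ℍ[ℝ])
    (h₃ h₄ : E →ₗ[ℝ] ℍ[ℝ]) : E →ₗ[ℝ] Module.End ℝ S where
  toFun x := (1 / 2 : ℝ) • (quat φ (h₃ x) + quat φ h₁ * cmul S x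
    + ε • (quat φ h₁ * cmul S x * ω) + quat φ (h₄ x) * ω)
  map_add' x y := by
    simp only [map_add, mul_add, add_mul]
    module
  map_smul' c x := by
    simp only [map_smul, mul_smul_comm, smul_mul_assoc, RingHom.id_apply]
    module

/-- First case: `Re h₁ ≠ 0`, the map `Im h₃` has rank at most one, and
`h₄(x) = -ε (Im h₁ × Im h₃(x)) / Re h₁`. -/
def FirstCase (ε : ℝ) (h₁ : ℍ[ℝ]) (h₃ h₄ : E →ₗ[ℝ] ℍ[ℝ]) : Prop :=
  h₁.re ≠ 0 ∧ Module.finrank ℝ (LinearMap.range (imₗ ∘ₗ h₃)) ≤ 1 ∧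
    ∀ x, h₄ x = -(ε / h₁.re) • cross h₁.im (h₃ x).im

/-- Second case: `Re h₁ = 0`, `Im h₁ ≠ 0`, the map `h₃ = r + c (Im h₁ / |Im h₁|)` takes values in
the copy `ℝ ⊕ ℝ (Im h₁ / |Im h₁|)` of the complex numbers, the map `h₄ = μ ν` takes values in the
real line spanned by an imaginary unit `ν` orthogonal to `Im h₁`, and `μ`, `c` have the same kernel
if neither of them vanishes. -/
def SecondCase (h₁ : ℍ[ℝ]) (h₃ h₄ : E →ₗ[ℝ] ℍ[ℝ]) : Prop :=
  h₁.re = 0 ∧ h₁.im ≠ 0 ∧ ∃ (r c μ : E →ₗ[ℝ] ℝ) (ν : ℍ[ℝ]),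
    ν.re = 0 ∧ ‖ν‖ = 1 ∧ inner ℝ h₁.im ν = 0 ∧
    (∀ x, h₃ x = (r x : ℍ[ℝ]) + c x • (‖h₁.im‖⁻¹ • h₁.im)) ∧
    (∀ x, h₄ x = μ x • ν) ∧
    (c ≠ 0 → μ ≠ 0 → LinearMap.ker μ = LinearMap.ker c)

end Spinors

end

end CahenWallach

/-!
In dimension `4` modulo `8`, averaging over the products of Clifford generators projects onto the
commutant, and averaging after symmetrization projects onto the scalars. The trace of the second
projection determines the dimension of `S`, and that of the first then shows that the commutant has
dimension `4`; as its symmetric elements are scalars, it is `ℍ`.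

On the blocks, the brackets of `E*` with `E` become `c(z) d(y) - a(y) c(z) = ⟨z, y⟩ Q`, where `c` is
Clifford multiplication and `√2 Q` the charge. Comparing this identity for orthogonal vectors shows
that Clifford multiplication intertwines `Q` with a conjugate of it, and hence also `d` with `a`
after a correction by Clifford terms. So `Q` lies in `ℍ + ℍω`, and so do the corrected `a` and `d`.
The remaining relations say that the quaternions `h₃(x) + ε h₄(x)` commute with one another and that
left multiplication by `h₁` intertwines them with `h₃(x) - ε h₄(x)`. Commuting quaternions have
imaginary parts on one line, and solving for `h₄` gives the two cases.
-/

namespace CahenWallach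

section Anticommuting

variable {ι A : Type*} [Ring A]

/-- A family of pairwise anticommuting square roots of `1`, i.e. of generators of a Clifford algebra
acting on an orthonormal basis. -/
structure IsAnticommuting (e : ι → A) : Prop where
  mul_self : ∀ i, e i * e i = 1
  anti : ∀ i j, i ≠ j → e i * e j = -(e j * e i)

namespace IsAnticommuting

variable {e : ι → A}

lemma mul_prod_of_notMem (he : IsAnticommuting e) {i : ι} {L : List ι} (hi : i ∉ L) :
    e i * (L.map e).prod = (-1 : ℤ) ^ L.length • ((L.map e).prod * e i) := by
  induction L with
  | nil => simp
  | cons a L ih =>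
    simp only [List.mem_cons, not_or] at hi
    rw [List.map_cons, List.prod_cons, ← mul_assoc, he.anti i a hi.1, neg_mul, mul_assoc, ih hi.2,
      mul_smul_comm, List.length_cons, pow_succ, mul_neg_one, neg_smul, mul_assoc]

lemma mul_prod_of_mem (he : IsAnticommuting e) {i : ι} {L : List ι} (hL : L.Nodup) (hi : i ∈ L) :
    e i * (L.map e).prod = -((-1 : ℤ) ^ L.length • ((L.map e).prod * e i)) := by
  induction L with
  | nil => simp at hi
  | cons a L ih =>
    rw [List.nodup_cons] at hL
    rw [List.map_cons, List.prod_cons, List.length_cons, pow_succ, mul_neg_one, neg_smul, neg_neg]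
    obtain rfl | h := eq_or_ne i a
    · rw [mul_assoc (e i) _ (e i), ← mul_smul_comm, ← he.mul_prod_of_notMem hL.1]
    · rw [← mul_assoc, he.anti i a h, neg_mul, mul_assoc, ih hL.2 (List.mem_of_ne_of_mem h hi),
        mul_neg, neg_neg, mul_smul_comm, mul_assoc]

lemma prod_mul_prod (he : IsAnticommuting e) {L : List ι} (hL : L.Nodup) :
    (L.map e).prod * (L.map e).prod = (-1 : ℤ) ^ L.length.choose 2 • 1 := by
  induction L with
  | nil => simp
  | cons a L ih =>
    rw [List.nodup_cons] at hL
    rw [List.map_cons, List.prod_cons]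
    nth_rw 1 [he.mul_prod_of_notMem hL.1]
    rw [smul_mul_assoc, mul_assoc, ← mul_assoc (e a), he.mul_self, one_mul, ih hL.2, smul_smul,
      ← pow_add, List.length_cons, Nat.choose_succ_succ' L.length 1, Nat.choose_one_right]

end IsAnticommuting

end Anticommuting

section Signs

lemma sum_map_pow_length_sublists' {α R : Type*} [CommSemiring R] (z : R) (l : List α) :
    (l.sublists'.map fun L => z ^ L.length).sum = (1 + z) ^ l.length := by
  induction l with
  | nil => simp
  | cons a l ih =>
    simp [Function.comp_def, pow_succ, List.sum_map_mul_right, ih, mul_add]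

lemma neg_one_pow_choose_two (k : ℕ) :
    (-1 : ℝ) ^ k.choose 2 = ((1 - Complex.I) * Complex.I ^ k).re := by
  have step (m : ℕ) : (m + 2).choose 2 = m.choose 2 + 2 * m + 1 := by
    simp only [Nat.choose_succ_succ' _ 1, Nat.choose_one_right]
    ring
  induction k using Nat.twoStepInduction with
  | zero => simp
  | one => simp
  | more m ih _ =>
    rw [step, pow_succ, pow_add, pow_mul, ih, pow_add, Complex.I_sq]
    simp

lemma sum_neg_one_pow_choose_two {α : Type*} {l : List α} {q : ℕ} (hl : l.length = 4 * q) :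
    (l.sublists'.map fun L => (-1 : ℝ) ^ L.length.choose 2).sum = (-4) ^ q := by
  have h4 : (1 + Complex.I) ^ 4 = ((-4 : ℝ) : ℂ) := by
    have h2 : (1 + Complex.I) ^ 2 = 2 * Complex.I := by linear_combination Complex.I_sq
    push_cast
    linear_combination ((1 + Complex.I) ^ 2 + 2 * Complex.I) * h2 + 4 * Complex.I_sq
  calc (l.sublists'.map fun L => (-1 : ℝ) ^ L.length.choose 2).sum
      = ((1 - Complex.I) * (l.sublists'.map fun L => Complex.I ^ L.length).sum).re := by
        simp only [neg_one_pow_choose_two, ← List.sum_map_mul_left]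
        exact ((map_list_sum Complex.reAddGroupHom _).trans (by rw [List.map_map]; rfl)).symm
    _ = ((1 - Complex.I) * ((-4 : ℝ) ^ q : ℝ)).re := by
        rw [sum_map_pow_length_sublists', hl, pow_mul, h4, Complex.ofReal_pow]
    _ = (-4) ^ q := by rw [Complex.re_mul_ofReal]; simp

end Signs

section Averaging

variable {ι A : Type*} [Ring A] [Algebra ℝ A]

lemma mem_centralizer_range {e : ι → A} {x : A} :
    x ∈ Subalgebra.centralizer ℝ (Set.range e) ↔ ∀ i, Commute (e i) x := by
  simp [Subalgebra.mem_centralizer_iff, commute_iff_eq]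

variable [StarRing A]

/-- The sum of the maps `x ↦ g x g⋆` over the products `g` of the sublists of `l`: up to scaling,
the average over the finite group generated by an anticommuting family. -/
def average (e : ι → A) (l : List ι) : A →ₗ[ℝ] A :=
  (l.sublists'.map fun L => LinearMap.mulLeftRight ℝ ((L.map e).prod, star (L.map e).prod)).sum

variable {e : ι → A}

lemma average_apply (l : List ι) (x : A) :
    average e l x =
      (l.sublists'.map fun L => (L.map e).prod * x * star (L.map e).prod).sum := by
  rw [average, ← LinearMap.applyₗ_apply_apply (R := ℝ) x, map_list_sum, List.map_map]
  rfl

lemma average_nil (x : A) : average e [] x = x := by simp [average]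

lemma average_cons (hs : ∀ i, IsSelfAdjoint (e i)) (i : ι) (l : List ι) (x : A) :
    average e (i :: l) x = average e l x + e i * average e l x * e i := by
  simp only [average_apply, List.sublists'_cons, List.map_append, List.sum_append, List.map_map,
    ← List.sum_map_mul_left, ← List.sum_map_mul_right]
  simp [Function.comp_def, (hs i).star_eq, mul_assoc]

lemma star_average (hs : ∀ i, IsSelfAdjoint (e i)) (l : List ι) (x : A) :
    star (average e l x) = average e l (star x) := by
  induction l with
  | nil => simp [average_nil]
  | cons i l ih => simp [average_cons hs, ih, (hs i).star_eq, mul_assoc]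

lemma commute_average (he : IsAnticommuting e) (hs : ∀ i, IsSelfAdjoint (e i)) {l : List ι}
    (x : A) {i : ι} (hi : i ∈ l) : Commute (e i) (average e l x) := by
  induction l with
  | nil => simp at hi
  | cons a l ih =>
    rw [average_cons hs]
    generalize average e l x = y at ih ⊢
    obtain rfl | h := eq_or_ne i a
    · rw [commute_iff_eq, mul_add, add_mul, ← mul_assoc (e i), ← mul_assoc (e i), he.mul_self,
        one_mul, mul_assoc (e i * y), he.mul_self, mul_one, add_comm]
    · have hy : e i * y = y * e i := ih (List.mem_of_ne_of_mem h hi)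
      refine .add_right hy ?_
      calc e i * (e a * y * e a) = (e i * e a) * y * e a := by noncomm_ring
        _ = -(e a * (e i * y) * e a) := by rw [he.anti i a h]; noncomm_ring
        _ = -(e a * y * (e i * e a)) := by rw [hy]; noncomm_ring
        _ = e a * y * e a * e i := by rw [he.anti i a h]; noncomm_ring

lemma average_of_commute (he : IsAnticommuting e) (hs : ∀ i, IsSelfAdjoint (e i)) (l : List ι)
    {x : A} (hx : ∀ i, Commute (e i) x) : average e l x = (2 : ℝ) ^ l.length • x := by
  induction l with
  | nil => simp [average_nil]
  | cons i l ih =>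
    rw [average_cons hs, ih, mul_smul_comm, smul_mul_assoc, (hx i).eq, mul_assoc, he.mul_self,
      mul_one, List.length_cons, pow_succ, mul_smul, two_smul, smul_add]

lemma average_mem_centralizer (he : IsAnticommuting e) (hs : ∀ i, IsSelfAdjoint (e i))
    {l : List ι} (hl : ∀ i, i ∈ l) (x : A) :
    average e l x ∈ Subalgebra.centralizer ℝ (Set.range e) :=
  mem_centralizer_range.2 fun i => commute_average he hs x (hl i)

lemma star_mem_centralizer (hs : ∀ i, IsSelfAdjoint (e i)) {x : A}
    (hx : x ∈ Subalgebra.centralizer ℝ (Set.range e)) :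
    star x ∈ Subalgebra.centralizer ℝ (Set.range e) := by
  rw [mem_centralizer_range] at hx ⊢
  intro i
  simpa only [(hs i).star_eq] using (hx i).star_star

lemma isProj_centralizer (he : IsAnticommuting e) (hs : ∀ i, IsSelfAdjoint (e i))
    {l : List ι} (hl : ∀ i, i ∈ l) :
    LinearMap.IsProj (Subalgebra.toSubmodule (Subalgebra.centralizer ℝ (Set.range e)))
      (((2 : ℝ) ^ l.length)⁻¹ • average e l) where
  map_mem x := Submodule.smul_mem _ _ (average_mem_centralizer he hs hl x)
  map_id x hx := by
    rw [LinearMap.smul_apply, average_of_commute he hs l (mem_centralizer_range.1 hx),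
      inv_smul_smul₀ (by positivity)]

variable [StarModule ℝ A]

variable (A) in
/-- The star operation of a real `*`-algebra as a linear map. -/
def starₗ : A →ₗ[ℝ] A where
  toFun := star
  map_add' := star_add
  map_smul' c x := by simp

lemma isProj_span_one (he : IsAnticommuting e) (hs : ∀ i, IsSelfAdjoint (e i))
    {l : List ι} (hl : ∀ i, i ∈ l)
    (hscal : ∀ a ∈ Subalgebra.centralizer ℝ (Set.range e), IsSelfAdjoint a → ∃ r : ℝ, a = r • 1) :
    LinearMap.IsProj (ℝ ∙ (1 : A))
      ((2 * (2 : ℝ) ^ l.length)⁻¹ • (average e l + average e l ∘ₗ starₗ A)) where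
  map_mem x := by
    refine Submodule.smul_mem _ _ (Submodule.mem_span_singleton.2 ?_)
    obtain ⟨r, hr⟩ := hscal (average e l (x + star x)) (average_mem_centralizer he hs hl _)
      (by rw [IsSelfAdjoint, star_average hs, star_add, star_star, add_comm])
    exact ⟨r, by rw [← hr, map_add]; rfl⟩
  map_id x hx := by
    obtain ⟨r, rfl⟩ := Submodule.mem_span_singleton.1 hx
    have hr (i : ι) : Commute (e i) (r • 1) := (Commute.one_right _).smul_right r
    have hstar : starₗ A (r • 1) = r • 1 := by simp [starₗ]
    rw [LinearMap.smul_apply, LinearMap.add_apply, LinearMap.comp_apply, hstar,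
      average_of_commute he hs l hr, ← two_smul ℝ, mul_inv_rev, mul_smul,
      inv_smul_smul₀ two_ne_zero, inv_smul_smul₀ (by positivity)]

end Averaging

section Trace

variable {n R M : Type*} [Fintype n] [DecidableEq n] [CommRing R] [AddCommGroup M] [Module R M]

lemma trace_end_eq_sum (b : Module.Basis n R M) (T : Module.End R M →ₗ[R] Module.End R M) :
    LinearMap.trace R (Module.End R M) T =
      ∑ i, ∑ j, LinearMap.toMatrix b b (T (Matrix.toLin b b (Matrix.single i j 1))) i j := by
  rw [LinearMap.trace_eq_matrix_trace R b.end, Matrix.trace, Fintype.sum_prod_type]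
  simp only [Matrix.diag_apply, LinearMap.toMatrix_apply b.end, Module.Basis.end_apply,
    Matrix.stdBasis_eq_single]
  rfl

lemma trace_mulLeftRight [Module.Free R M] [Module.Finite R M] (f g : Module.End R M) :
    LinearMap.trace R (Module.End R M) (LinearMap.mulLeftRight R (f, g)) =
      LinearMap.trace R M f * LinearMap.trace R M g := by
  classical
  let b := Module.Free.chooseBasis R M
  rw [trace_end_eq_sum b, LinearMap.trace_eq_matrix_trace R b, LinearMap.trace_eq_matrix_trace R b,
    Matrix.trace, Matrix.trace, Finset.sum_mul_sum]
  simp [LinearMap.toMatrix_mul, Matrix.mul_apply, Matrix.single_apply, ite_and]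

variable {V : Type*} [NormedAddCommGroup V] [InnerProductSpace ℝ V] [FiniteDimensional ℝ V]

lemma trace_mulLeftRight_comp_starₗ (f g : Module.End ℝ V) :
    LinearMap.trace ℝ (Module.End ℝ V) (LinearMap.mulLeftRight ℝ (f, g) ∘ₗ starₗ _) =
      LinearMap.trace ℝ V (f * star g) := by
  let v := stdOrthonormalBasis ℝ V
  have hstar (h : Module.End ℝ V) : LinearMap.toMatrix v.toBasis v.toBasis (star h) =
      (LinearMap.toMatrix v.toBasis v.toBasis h).conjTranspose := LinearMap.toMatrix_adjoint v v h
  rw [trace_end_eq_sum v.toBasis, LinearMap.trace_eq_matrix_trace ℝ v.toBasis,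
    LinearMap.toMatrix_mul, hstar, Matrix.trace]
  simp [starₗ, LinearMap.toMatrix_mul, hstar, Matrix.mul_apply, Matrix.single_apply, ite_and]

end Trace

section Centralizer

variable {ι V : Type*}

section

variable [AddCommGroup V] [Module ℝ V] {e : ι → Module.End ℝ V}

lemma trace_eq_zero_of_anticommute {f g : Module.End ℝ V} (hg : g * g = 1)
    (h : g * f = -(f * g)) : LinearMap.trace ℝ V f = 0 := by
  have hconj : LinearMap.trace ℝ V (g * f * g) = LinearMap.trace ℝ V f := by
    rw [LinearMap.trace_mul_comm, ← mul_assoc, hg, one_mul]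
  rw [h, neg_mul, mul_assoc, hg, mul_one, map_neg] at hconj
  linarith

lemma IsAnticommuting.trace_prod_eq_zero [Fintype ι] (he : IsAnticommuting e)
    (hι : Even (Fintype.card ι)) {L : List ι} (hL : L.Nodup) (h0 : L ≠ []) :
    LinearMap.trace ℝ V (L.map e).prod = 0 := by
  classical
  rcases Nat.even_or_odd L.length with h | h
  · obtain ⟨i, hi⟩ := List.exists_mem_of_ne_nil L h0
    refine trace_eq_zero_of_anticommute (he.mul_self i) ?_
    rw [he.mul_prod_of_mem hL hi, h.neg_one_pow, one_smul]
  · obtain ⟨i, hi⟩ : ∃ i, i ∉ L := by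
      by_contra! hmem
      have huniv : L.toFinset = Finset.univ := by ext i; simp [hmem]
      rw [← Finset.card_univ, ← huniv, List.toFinset_card_of_nodup hL] at hι
      exact Nat.not_even_iff_odd.2 h hι
    refine trace_eq_zero_of_anticommute (he.mul_self i) ?_
    rw [he.mul_prod_of_notMem hi, h.neg_one_pow, neg_smul, one_smul]

end

variable [NormedAddCommGroup V] [InnerProductSpace ℝ V] [FiniteDimensional ℝ V]
  {e : ι → Module.End ℝ V}

lemma trace_average [Fintype ι] (he : IsAnticommuting e) (hι : Even (Fintype.card ι))
    {l : List ι} (hl : l.Nodup) :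
    LinearMap.trace ℝ _ (average e l) = (Module.finrank ℝ V : ℝ) ^ 2 := by
  classical
  rw [average, map_list_sum, List.map_map, ← List.sum_toFinset _ (List.nodup_sublists'.2 hl),
    Finset.sum_eq_single []]
  · rw [Function.comp_apply, trace_mulLeftRight]
    simp [sq]
  · intro L hL h0
    rw [List.mem_toFinset, List.mem_sublists'] at hL
    rw [Function.comp_apply, trace_mulLeftRight, he.trace_prod_eq_zero hι (hL.nodup hl) h0,
      zero_mul]
  · simp

lemma trace_average_comp_starₗ (he : IsAnticommuting e) {l : List ι} (hl : l.Nodup) :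
    LinearMap.trace ℝ _ (average e l ∘ₗ starₗ _) =
      (l.sublists'.map fun L => (-1 : ℝ) ^ L.length.choose 2).sum * Module.finrank ℝ V := by
  have hcomp : average e l ∘ₗ starₗ _ = (l.sublists'.map fun L =>
      LinearMap.mulLeftRight ℝ ((L.map e).prod, star (L.map e).prod) ∘ₗ starₗ _).sum := by
    rw [average]
    exact (map_list_sum (LinearMap.lcomp ℝ _ (starₗ _)) _).trans (by rw [List.map_map]; rfl)
  rw [hcomp, map_list_sum, List.map_map, ← List.sum_map_mul_right]
  refine congrArg List.sum (List.map_congr_left fun L hL => ?_)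
  rw [Function.comp_apply, trace_mulLeftRight_comp_starₗ, star_star,
    he.prod_mul_prod ((List.mem_sublists'.1 hL).nodup hl), map_zsmul, LinearMap.trace_one]
  simp

lemma finrank_centralizer [Fintype ι] [Nontrivial V] (he : IsAnticommuting e)
    (hs : ∀ i, IsSelfAdjoint (e i)) (hι : Fintype.card ι % 8 = 4)
    (hscal : ∀ A ∈ Subalgebra.centralizer ℝ (Set.range e), IsSelfAdjoint A →
      ∃ r : ℝ, A = r • 1) :
    Module.finrank ℝ (Subalgebra.centralizer ℝ (Set.range e)) = 4 := by
  set l : List ι := Finset.univ.toList with hl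
  have hnodup : l.Nodup := Finset.nodup_toList _
  have hmem : ∀ i, i ∈ l := by simp [hl]
  obtain ⟨k, hk⟩ : ∃ k, Fintype.card ι = 4 * (2 * k + 1) := ⟨Fintype.card ι / 8, by omega⟩
  have hlen : l.length = 4 * (2 * k + 1) := by simp [hl, hk]
  have hι_even : Even (Fintype.card ι) := ⟨2 * (2 * k + 1), by omega⟩
  set c : ℝ := 4 ^ (2 * k + 1) with hc
  have hc0 : 0 < c := by positivity
  have hpow : (2 : ℝ) ^ l.length = c ^ 2 := by
    rw [hlen, hc, pow_right_comm, pow_mul]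
    norm_num
  have htrace := (isProj_centralizer he hs hmem).trace
  have htrace_one := (isProj_span_one he hs hmem hscal).trace
  rw [map_smul, trace_average he hι_even hnodup, hpow, smul_eq_mul] at htrace
  rw [finrank_span_singleton one_ne_zero, map_smul, map_add, trace_average he hι_even hnodup,
    trace_average_comp_starₗ he hnodup, sum_neg_one_pow_choose_two hlen, hpow, smul_eq_mul,
    Odd.neg_pow ⟨k, rfl⟩] at htrace_one
  have hV : (Module.finrank ℝ V : ℝ) = 2 * c := by
    have hroots : ((Module.finrank ℝ V : ℝ) - 2 * c) * (Module.finrank ℝ V + c) = 0 := by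
      field_simp at htrace_one
      push_cast at htrace_one
      linear_combination htrace_one
    refine sub_eq_zero.1 ((mul_eq_zero.1 hroots).resolve_right ?_)
    positivity
  rw [hV, mul_pow, mul_comm, mul_assoc, mul_inv_cancel₀ (by positivity)] at htrace
  have h4 : (4 : ℝ) = Module.finrank ℝ (Subalgebra.centralizer ℝ (Set.range e)) := by
    rw [← Subalgebra.finrank_toSubmodule, ← htrace]
    norm_num
  exact_mod_cast h4.symm

end Centralizer

section Frobenius

lemma nonempty_quaternion_algEquiv {A : Type*} [Ring A] [Algebra ℝ A]
    (hdim : Module.finrank ℝ A = 4) {I J : A} (hI : I * I = -1) (hJ : J * J = -1)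
    (hIJ : J * I = -(I * J)) : Nonempty (ℍ[ℝ] ≃ₐ[ℝ] A) := by
  let q : QuaternionAlgebra.Basis A (-1 : ℝ) 0 (-1) :=
    { i := I, j := J, k := I * J, i_mul_i := by simp [hI], j_mul_j := by simp [hJ]
      i_mul_j := rfl, j_mul_i := by simp [hIJ] }
  have : Nontrivial A := Module.nontrivial_of_finrank_pos (R := ℝ) (by omega)
  have : FiniteDimensional ℝ A := Module.finite_of_finrank_pos (by omega)
  let f : ℍ[ℝ] →ₐ[ℝ] A := q.liftHom
  have hinj : Function.Injective f := RingHom.injective (f : ℍ[ℝ] →+* A)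
  have hsurj : Function.Surjective f :=
    (LinearMap.injective_iff_surjective_of_finrank_eq_finrank (f := f.toLinearMap)
      (by rw [Quaternion.finrank_eq_four, hdim])).1 hinj
  exact ⟨AlgEquiv.ofBijective f ⟨hinj, hsurj⟩⟩

lemma exists_mem_notMem_span {K M : Type*} [DivisionRing K] [AddCommGroup M] [Module K M]
    {W : Submodule K M} {s : Finset M} (hs : s.card < Module.finrank K W) :
    ∃ x ∈ W, x ∉ Submodule.span K (s : Set M) := by
  by_contra! h
  exact hs.not_ge ((Submodule.finrank_mono h).trans (finrank_span_finset_le_card s))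

lemma exists_smul_one_add_skewAdjoint {A : Type*} [Ring A] [Algebra ℝ A] [StarRing A]
    [StarModule ℝ A] {D : Subalgebra ℝ A} (hstar : ∀ a ∈ D, star a ∈ D)
    (hscal : ∀ a ∈ D, IsSelfAdjoint a → ∃ r : ℝ, a = r • 1) {a : A} (ha : a ∈ D) :
    ∃ r : ℝ, ∃ k ∈ D, star k = -k ∧ a = r • 1 + k := by
  obtain ⟨r, hr⟩ := hscal ((1 / 2 : ℝ) • (a + star a))
    (D.smul_mem (add_mem ha (hstar a ha)) _) (by simp [IsSelfAdjoint, add_comm])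
  refine ⟨r, (1 / 2 : ℝ) • (a - star a), D.smul_mem (sub_mem ha (hstar a ha)) _,
    by simp [← smul_neg], ?_⟩
  rw [← hr]
  module

variable {V : Type*} [NormedAddCommGroup V] [InnerProductSpace ℝ V] [FiniteDimensional ℝ V]
  {D : Subalgebra ℝ (Module.End ℝ V)}

lemma exists_smul_mul_self_eq_neg_one
    (hscal : ∀ A ∈ D, IsSelfAdjoint A → ∃ r : ℝ, A = r • 1) {A : Module.End ℝ V} (hA : A ∈ D)
    (hskew : star A = -A) (h0 : A ≠ 0) : ∃ s : ℝ, (s • A) * (s • A) = -1 := by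
  obtain ⟨r, hr⟩ := hscal (A * A) (mul_mem hA hA) (by
    rw [IsSelfAdjoint, star_mul, hskew, neg_mul_neg])
  have hneg : r < 0 := by
    obtain ⟨x, hx⟩ : ∃ x, A x ≠ 0 := by
      by_contra! h
      exact h0 (LinearMap.ext h)
    have hnorm : inner ℝ (A x) (A x) = -r * inner ℝ x x := by
      rw [← LinearMap.adjoint_inner_left, ← LinearMap.star_eq_adjoint, hskew, LinearMap.neg_apply,
        ← Module.End.mul_apply, hr]
      simp [inner_smul_left]
    have hpos : 0 < inner ℝ (A x) (A x) := real_inner_self_pos.2 hx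
    nlinarith [real_inner_self_nonneg (x := x)]
  refine ⟨(√(-r))⁻¹, ?_⟩
  rw [smul_mul_smul_comm, hr, smul_smul, ← mul_inv, Real.mul_self_sqrt (by linarith), inv_neg,
    neg_mul, inv_mul_cancel₀ hneg.ne, neg_one_smul]

lemma exists_skewAdjoint_notMem_span (hdim : Module.finrank ℝ D = 4)
    (hstar : ∀ A ∈ D, star A ∈ D) (hscal : ∀ A ∈ D, IsSelfAdjoint A → ∃ r : ℝ, A = r • 1)
    {s : Finset (Module.End ℝ V)} (hs : s.card < 4) (h1 : 1 ∈ s) :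
    ∃ K ∈ D, star K = -K ∧ K ∉ Submodule.span ℝ (s : Set (Module.End ℝ V)) := by
  obtain ⟨A, hA, hAs⟩ := exists_mem_notMem_span (W := Subalgebra.toSubmodule D)
    (hs.trans_eq hdim.symm)
  obtain ⟨r, K, hK, hskew, rfl⟩ := exists_smul_one_add_skewAdjoint hstar hscal hA
  exact ⟨K, hK, hskew, fun h => hAs
    (add_mem (Submodule.smul_mem _ r (Submodule.subset_span h1)) h)⟩

lemma exists_anticommuting_mul_self_eq_neg_one (hdim : Module.finrank ℝ D = 4)
    (hstar : ∀ A ∈ D, star A ∈ D) (hscal : ∀ A ∈ D, IsSelfAdjoint A → ∃ r : ℝ, A = r • 1)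
    {I : Module.End ℝ V} (hID : I ∈ D) (hIskew : star I = -I) (hI : I * I = -1) :
    ∃ J ∈ D, J * J = -1 ∧ J * I = -(I * J) := by
  classical
  obtain ⟨K, hKD, hKskew, hK⟩ := exists_skewAdjoint_notMem_span hdim hstar hscal (s := {1, I})
    (Finset.card_le_two.trans_lt (by norm_num)) (by simp)
  obtain ⟨t, ht⟩ := hscal (I * K + K * I) (add_mem (mul_mem hID hKD) (mul_mem hKD hID))
    (by rw [IsSelfAdjoint, star_add, star_mul, star_mul, hIskew, hKskew, neg_mul_neg, neg_mul_neg,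
      add_comm])
  -- subtracting from `K` its component along `I` makes it anticommute with `I`
  obtain ⟨r, hr⟩ := exists_smul_mul_self_eq_neg_one hscal (A := K + (t / 2) • I)
    (add_mem hKD (D.smul_mem hID _)) (by simp [hIskew, hKskew, add_comm]) fun h0 => hK <| by
      rw [eq_neg_of_add_eq_zero_left h0]
      exact neg_mem (Submodule.smul_mem _ _ (Submodule.subset_span (by simp)))
  refine ⟨r • (K + (t / 2) • I), D.smul_mem (add_mem hKD (D.smul_mem hID _)) _, hr, ?_⟩
  have hKI : K * I = t • 1 - I * K := by rw [← ht]; abel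
  simp only [smul_mul_assoc, mul_smul_comm, add_mul, mul_add, hI, hKI]
  module

theorem nonempty_quaternion_algEquiv_of_finrank (hdim : Module.finrank ℝ D = 4)
    (hstar : ∀ A ∈ D, star A ∈ D) (hscal : ∀ A ∈ D, IsSelfAdjoint A → ∃ r : ℝ, A = r • 1) :
    Nonempty (ℍ[ℝ] ≃ₐ[ℝ] D) := by
  obtain ⟨K, hKD, hKskew, hK⟩ := exists_skewAdjoint_notMem_span hdim hstar hscal (s := {1})
    (by simp) (by simp)
  obtain ⟨s, hI⟩ := exists_smul_mul_self_eq_neg_one hscal hKD hKskew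
    (by rintro rfl; exact hK (zero_mem _))
  obtain ⟨J, hJD, hJ, hJI⟩ := exists_anticommuting_mul_self_eq_neg_one hdim hstar hscal
    (D.smul_mem hKD s) (by rw [star_smul, hKskew, smul_neg, star_trivial]) hI
  exact nonempty_quaternion_algEquiv hdim (I := ⟨s • K, D.smul_mem hKD s⟩) (J := ⟨J, hJD⟩)
    (Subtype.ext hI) (Subtype.ext hJ) (Subtype.ext hJI)

end Frobenius

section Isometries

variable {ι V : Type*} [AddCommGroup V] [Module ℝ V] {e : ι → Module.End ℝ V}

lemma IsAnticommuting.apply_apply_self (he : IsAnticommuting e) (i : ι) (x : V) :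
    e i (e i x) = x :=
  LinearMap.congr_fun (he.mul_self i) x

lemma IsAnticommuting.apply_apply (he : IsAnticommuting e) {i j : ι} (h : i ≠ j) (x : V) :
    e i (e j x) = -e j (e i x) :=
  LinearMap.congr_fun (he.anti i j h) x

lemma IsAnticommuting.exists_finiteDimensional_invariant (he : IsAnticommuting e) (s : V)
    (l : List ι) : ∃ W : Submodule ℝ V, FiniteDimensional ℝ W ∧ s ∈ W ∧
      ∀ i ∈ l, W ∈ (e i).invtSubmodule := by
  induction l with
  | nil => exact ⟨Submodule.span ℝ {s}, inferInstance, Submodule.mem_span_singleton_self s, by simp⟩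
  | cons a l ih =>
    obtain ⟨W, hfin, hs, hW⟩ := ih
    refine ⟨W ⊔ W.map (e a), inferInstance, Submodule.mem_sup_left hs, fun i hi => ?_⟩
    rw [Module.End.mem_invtSubmodule, sup_le_iff, Submodule.map_le_iff_le_comap]
    obtain rfl | h := eq_or_ne i a
    · exact ⟨fun t ht => Submodule.mem_sup_right (Submodule.mem_map_of_mem ht),
        fun t ht => Submodule.mem_sup_left (by simpa [he.apply_apply_self] using ht)⟩
    · have hWi : ∀ t ∈ W, e i t ∈ W := hW i (List.mem_of_ne_of_mem h hi)
      exact ⟨fun t ht => Submodule.mem_sup_left (hWi t ht), fun t ht => Submodule.mem_sup_right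
        ⟨-e i t, neg_mem (hWi t ht), by simp [he.apply_apply h]⟩⟩

lemma exists_isSymm_forall_pos (V : Type*) [AddCommGroup V] [Module ℝ V] [FiniteDimensional ℝ V] :
    ∃ B : LinearMap.BilinForm ℝ V, B.IsSymm ∧ ∀ x ≠ 0, 0 < B x x := by
  let f := (Module.finBasis ℝ V).equivFun ≪≫ₗ (WithLp.linearEquiv 2 ℝ _).symm
  refine ⟨(innerₗ _).compl₁₂ f.toLinearMap f.toLinearMap,
    ⟨fun x y => real_inner_comm (f y) (f x)⟩, fun x hx => ?_⟩
  exact real_inner_self_pos.2 (f.map_ne_zero_iff.2 hx)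

lemma IsAnticommuting.exists_invariant_bilinForm [FiniteDimensional ℝ V] (he : IsAnticommuting e)
    (l : List ι) : ∃ B : LinearMap.BilinForm ℝ V, B.IsSymm ∧ (∀ x ≠ 0, 0 < B x x) ∧
      ∀ i ∈ l, ∀ x y, B (e i x) (e i y) = B x y := by
  induction l with
  | nil => simpa using exists_isSymm_forall_pos V
  | cons a l ih =>
    obtain ⟨B, hsymm, hpos, hB⟩ := ih
    refine ⟨B + B.compl₁₂ (e a) (e a), ⟨fun x y => ?_⟩, fun x hx => ?_, fun i hi x y => ?_⟩
    · simp [hsymm.eq x, hsymm.eq (e a x)]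
    · have hax : e a x ≠ 0 := fun h => hx (by rw [← he.apply_apply_self a x, h, map_zero])
      exact add_pos (hpos x hx) (hpos _ hax)
    · simp only [LinearMap.add_apply, LinearMap.compl₁₂_apply]
      obtain rfl | h := eq_or_ne i a
      · rw [he.apply_apply_self, he.apply_apply_self, add_comm]
      · have hBi := hB i (List.mem_of_ne_of_mem h hi)
        simp only [he.apply_apply h.symm, map_neg, LinearMap.neg_apply, neg_neg, hBi]

lemma isSelfAdjoint_of_isometry {V : Type*} [NormedAddCommGroup V] [InnerProductSpace ℝ V]
    [FiniteDimensional ℝ V] {A : Module.End ℝ V} (hA : A * A = 1)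
    (hiso : ∀ x y, inner ℝ (A x) (A y) = inner ℝ x y) : IsSelfAdjoint A := by
  rw [← LinearMap.isSymmetric_iff_isSelfAdjoint]
  intro x y
  rw [← hiso x, ← Module.End.mul_apply A A, hA, Module.End.one_apply]

end Isometries

section Spinors

variable {E : Type*} [NormedAddCommGroup E] [InnerProductSpace ℝ E]
variable {S : Type*} [AddCommGroup S] [Module ℝ S] [Module (Cl E) S] [IsScalarTower ℝ (Cl E) S]

lemma cmul_mul_self (x : E) : cmul S x * cmul S x = (inner ℝ x x : ℝ) • 1 :=
  LinearMap.ext fun s => by simp [cmul_cmul]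

lemma cmul_mul_cmul_add (x y : E) :
    cmul S x * cmul S y + cmul S y * cmul S x = (2 * inner ℝ x y : ℝ) • 1 := by
  have h := cmul_mul_self (S := S) (x + y)
  rw [map_add, add_mul, mul_add, mul_add, cmul_mul_self, cmul_mul_self, inner_add_left,
    inner_add_right, inner_add_right, real_inner_comm x y] at h
  rw [← sub_eq_zero] at h ⊢
  rw [← h]
  module

lemma cmul_mul_cmul_of_inner_eq_zero {x y : E} (h : inner ℝ x y = (0 : ℝ)) :
    cmul S x * cmul S y = -(cmul S y * cmul S x) := by
  rw [eq_neg_iff_add_eq_zero, cmul_mul_cmul_add, h, mul_zero, zero_smul]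

lemma isAnticommuting_cmul {ι : Type*} {e : ι → E} (he : Orthonormal ℝ e) :
    IsAnticommuting fun i => cmul S (e i) where
  mul_self i := by rw [cmul_mul_self, real_inner_self_eq_norm_sq, he.1, one_pow, one_smul]
  anti i j h := cmul_mul_cmul_of_inner_eq_zero (he.2 h)

lemma mem_evenSchur {A : Module.End ℝ S} :
    A ∈ evenSchur E S ↔ ∀ x : E, Commute (cmul S x) A :=
  mem_centralizer_range

lemma evenSchur_eq_centralizer_basis {ι : Type*} (e : Module.Basis ι ℝ E) :
    evenSchur E S = Subalgebra.centralizer ℝ (Set.range fun i => cmul S (e i)) := by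
  ext A
  rw [mem_evenSchur, mem_centralizer_range]
  refine ⟨fun h i => h _, fun h x => ?_⟩
  induction e.mem_span x using Submodule.span_induction with
  | mem x hx => obtain ⟨i, rfl⟩ := hx; exact h i
  | zero => rw [map_zero]; exact Commute.zero_left A
  | add x y _ _ hx hy => rw [map_add]; exact hx.add_left hy
  | smul r x _ hx => rw [map_smul]; exact hx.smul_left r

variable (E) in
lemma eq_bot_or_eq_top_of_cmul_mem [IsSimpleModule (Cl E) S] (W : Submodule ℝ S)
    (hW : ∀ x : E, W ∈ (cmul S x).invtSubmodule) : W = ⊥ ∨ W = ⊤ := by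
  have hsmul : ∀ (a : Cl E), ∀ s ∈ W, a • s ∈ W := fun a => by
    induction a using CliffordAlgebra.induction with
    | algebraMap r => intro s hs; rw [algebraMap_smul]; exact W.smul_mem _ hs
    | ι x => exact hW x
    | mul a b ha hb => intro s hs; rw [mul_smul]; exact ha _ (hb _ hs)
    | add a b ha hb => intro s hs; rw [add_smul]; exact W.add_mem (ha _ hs) (hb _ hs)
  let W' : Submodule (Cl E) S := { W with smul_mem' := fun a s hs => hsmul a s hs }
  have hW' : (W' : Set S) = W := rfl
  simpa only [SetLike.ext'_iff, hW', Submodule.bot_coe, Submodule.top_coe]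
    using eq_bot_or_eq_top W'

variable (E S) in
lemma finiteDimensional_of_isSimpleModule [FiniteDimensional ℝ E] [IsSimpleModule (Cl E) S] :
    FiniteDimensional ℝ S := by
  have : Nontrivial S := IsSimpleModule.nontrivial (Cl E) S
  obtain ⟨s, hs⟩ := exists_ne (0 : S)
  let e := stdOrthonormalBasis ℝ E
  obtain ⟨W, hfin, hsW, hW⟩ := (isAnticommuting_cmul (S := S)
    e.orthonormal).exists_finiteDimensional_invariant s Finset.univ.toList
  have hstable : ∀ x : E, W ∈ (cmul S x).invtSubmodule := fun x t ht => by
    rw [← e.sum_repr x, Submodule.mem_comap, map_sum, LinearMap.sum_apply]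
    refine W.sum_mem fun i _ => ?_
    rw [map_smul]
    exact W.smul_mem _ (hW i (by simp) ht)
  obtain rfl | rfl := eq_bot_or_eq_top_of_cmul_mem E W hstable
  · exact absurd hsW hs
  · exact Module.Finite.equiv Submodule.topEquiv

lemma eq_smul_one_of_hasEigenvalue [IsSimpleModule (Cl E) S] {A : Module.End ℝ S}
    (hA : A ∈ evenSchur E S) {c : ℝ} (hc : A.HasEigenvalue c) : A = c • 1 := by
  have hstable : ∀ x : E, A.eigenspace c ∈ (cmul S x).invtSubmodule := fun x s hs => by
    rw [Submodule.mem_comap, Module.End.mem_eigenspace_iff] at *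
    rw [← Module.End.mul_apply, ← mem_evenSchur.1 hA x, Module.End.mul_apply, hs, map_smul]
  have htop := (eq_bot_or_eq_top_of_cmul_mem E _ hstable).resolve_left hc
  ext s
  have hs : s ∈ A.eigenspace c := htop ▸ Submodule.mem_top
  simpa using Module.End.mem_eigenspace_iff.1 hs

end Spinors

section EvenSchur

variable {E : Type*} [NormedAddCommGroup E] [InnerProductSpace ℝ E] [FiniteDimensional ℝ E]

lemma nonempty_quaternion_algEquiv_evenSchur_of_isSelfAdjoint {S : Type*} [NormedAddCommGroup S]
    [InnerProductSpace ℝ S] [FiniteDimensional ℝ S] [Module (Cl E) S] [IsScalarTower ℝ (Cl E) S]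
    [IsSimpleModule (Cl E) S] (hdim : Module.finrank ℝ E % 8 = 4)
    (hadj : ∀ i, IsSelfAdjoint (cmul S (stdOrthonormalBasis ℝ E i))) :
    Nonempty (ℍ[ℝ] ≃ₐ[ℝ] evenSchur E S) := by
  have : Nontrivial S := IsSimpleModule.nontrivial (Cl E) S
  have hanti := isAnticommuting_cmul (S := S) (stdOrthonormalBasis ℝ E).orthonormal
  have heq := evenSchur_eq_centralizer_basis (S := S) (stdOrthonormalBasis ℝ E).toBasis
  simp only [OrthonormalBasis.coe_toBasis] at heq
  have hscal : ∀ A ∈ evenSchur E S, IsSelfAdjoint A → ∃ r : ℝ, A = r • 1 := fun A hA hsA =>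
    ⟨_, eq_smul_one_of_hasEigenvalue hA
      ((LinearMap.isSymmetric_iff_isSelfAdjoint A).2 hsA).hasEigenvalue_iSup_of_finiteDimensional⟩
  rw [heq] at hscal ⊢
  exact nonempty_quaternion_algEquiv_of_finrank
    (finrank_centralizer hanti hadj (by simpa using hdim) hscal)
    (fun A hA => star_mem_centralizer hadj hA) hscal

theorem nonempty_quaternion_algEquiv_evenSchur {S : Type*} [AddCommGroup S] [Module ℝ S]
    [Module (Cl E) S] [IsScalarTower ℝ (Cl E) S] [IsSimpleModule (Cl E) S]
    (hdim : Module.finrank ℝ E % 8 = 4) : Nonempty (ℍ[ℝ] ≃ₐ[ℝ] evenSchur E S) := by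
  have : FiniteDimensional ℝ S := finiteDimensional_of_isSimpleModule E S
  have hanti := isAnticommuting_cmul (S := S) (stdOrthonormalBasis ℝ E).orthonormal
  obtain ⟨B, hsymm, hpos, hB⟩ := hanti.exists_invariant_bilinForm Finset.univ.toList
  let core : InnerProductSpace.Core ℝ S :=
    { inner := fun x y => B x y
      conj_inner_symm := fun x y => hsymm.eq y x
      re_inner_nonneg := fun x => by
        obtain rfl | hx := eq_or_ne x 0
        · simp
        · exact (hpos x hx).le
      add_left := fun x y z => by simp
      smul_left := fun x y r => by simp
      definite := fun x hx => not_imp_comm.1 (hpos x) hx.not_gt }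
  let _ : NormedAddCommGroup S := core.toNormedAddCommGroup
  let _ : InnerProductSpace ℝ S := InnerProductSpace.ofCore core.toCore
  exact nonempty_quaternion_algEquiv_evenSchur_of_isSelfAdjoint hdim fun i =>
    isSelfAdjoint_of_isometry (hanti.mul_self i) (hB i (by simp))

end EvenSchur

section LinearForms

variable {K V W : Type*} [Field K] [AddCommGroup V] [Module K V] [AddCommGroup W] [Module K W]

lemma exists_smul_and_smul_iff_ker_eq {f g : Module.Dual K V} :
    (∃ (l : Module.Dual K V) (s t : K), f = s • l ∧ g = t • l) ↔
      (f ≠ 0 → g ≠ 0 → LinearMap.ker g = LinearMap.ker f) := by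
  constructor
  · rintro ⟨l, s, t, rfl, rfl⟩ hs ht
    rw [LinearMap.ker_smul _ _ (left_ne_zero_of_smul hs),
      LinearMap.ker_smul _ _ (left_ne_zero_of_smul ht)]
  · intro h
    obtain rfl | hf := eq_or_ne f 0
    · exact ⟨g, 0, 1, by simp, by simp⟩
    obtain rfl | hg := eq_or_ne g 0
    · exact ⟨f, 1, 0, by simp, by simp⟩
    obtain ⟨t, rfl⟩ : ∃ t : K, t • f = g := by
      simpa [Submodule.mem_span_singleton] using
        mem_span_of_iInf_ker_le_ker (L := fun _ : Unit => f) (by simpa using (h hf hg).ge)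
    exact ⟨f, 1, t, by simp, rfl⟩

lemma finrank_range_le_one_iff_exists_smulRight [FiniteDimensional K W] {f : V →ₗ[K] W} :
    Module.finrank K (LinearMap.range f) ≤ 1 ↔
      ∃ (l : Module.Dual K V) (w : W), f = l.smulRight w := by
  constructor
  · intro h
    obtain ⟨⟨w, hw⟩, hspan⟩ := finrank_le_one_iff.1 h
    have hfw : ∀ x, ∃ c : K, c • w = f x := fun x =>
      (hspan ⟨f x, f.mem_range_self x⟩).imp fun c hc => congrArg Subtype.val hc
    obtain rfl | hw0 := eq_or_ne w 0
    · exact ⟨0, 0, LinearMap.ext fun x => by simpa using (hfw x).choose_spec.symm⟩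
    obtain ⟨g, hg⟩ := Module.Projective.exists_dual_eq_one K hw0
    refine ⟨g ∘ₗ f, w, LinearMap.ext fun x => ?_⟩
    obtain ⟨c, hc⟩ := hfw x
    simp [← hc, hg]
  · rintro ⟨l, w, rfl⟩
    refine (Submodule.finrank_mono ?_).trans (finrank_span_le_card {w} |>.trans (by simp))
    rintro _ ⟨x, rfl⟩
    exact Submodule.smul_mem _ _ (Submodule.mem_span_singleton_self w)

lemma exists_norm_eq_one_smul {F : Type*} [NormedAddCommGroup F] [NormedSpace ℝ F] [Nontrivial F]
    (w : F) : ∃ ν : F, ‖ν‖ = 1 ∧ ∃ t : ℝ, w = t • ν := by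
  obtain rfl | hw := eq_or_ne w 0
  · obtain ⟨ν, hν⟩ := exists_norm_eq F zero_le_one
    exact ⟨ν, hν, 0, by simp⟩
  · exact ⟨‖w‖⁻¹ • w, by simp [norm_smul, hw], ‖w‖, by simp [smul_smul, hw]⟩

end LinearForms

section Quaternions

lemma re_cross (a b : ℍ[ℝ]) : (cross a b).re = 0 := rfl

lemma imI_cross (a b : ℍ[ℝ]) : (cross a b).imI = a.imJ * b.imK - a.imK * b.imJ := rfl

lemma imJ_cross (a b : ℍ[ℝ]) : (cross a b).imJ = a.imK * b.imI - a.imI * b.imK := rfl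

lemma imK_cross (a b : ℍ[ℝ]) : (cross a b).imK = a.imI * b.imJ - a.imJ * b.imI := rfl

lemma mul_sub_mul_eq_cross (a b : ℍ[ℝ]) : a * b - b * a = (2 : ℝ) • cross a.im b.im := by
  ext <;> simp [re_cross, imI_cross, imJ_cross, imK_cross] <;> ring

lemma commute_iff_cross_eq_zero {a b : ℍ[ℝ]} : Commute a b ↔ cross a.im b.im = 0 := by
  rw [commute_iff_eq, ← sub_eq_zero, mul_sub_mul_eq_cross, smul_eq_zero_iff_right two_ne_zero]

lemma commute_im_im {a b : ℍ[ℝ]} : Commute a.im b.im ↔ Commute a b := by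
  simp only [commute_iff_cross_eq_zero, Quaternion.im_idem]

lemma mul_add_mul_of_re_eq_zero {b : ℍ[ℝ]} (v : ℍ[ℝ]) (hb : b.re = 0) :
    v * b + b * v = (2 : ℝ) • (v.re • b - ((inner ℝ v.im b : ℝ) : ℍ[ℝ])) := by
  ext <;> simp [Quaternion.inner_def, hb] <;> ring

lemma inner_cross_left (a b : ℍ[ℝ]) : inner ℝ a (cross a b) = 0 := by
  simp [Quaternion.inner_def, re_cross, imI_cross, imJ_cross, imK_cross]
  ring

lemma inner_cross_right (a b : ℍ[ℝ]) : inner ℝ b (cross a b) = 0 := by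
  simp [Quaternion.inner_def, re_cross, imI_cross, imJ_cross, imK_cross]
  ring

lemma inner_one_left (a : ℍ[ℝ]) : inner ℝ 1 a = a.re := by
  simp [Quaternion.inner_def]

lemma re_eq_of_semiconjBy {v p m : ℍ[ℝ]} (hv : v ≠ 0) (h : SemiconjBy v p m) : m.re = p.re := by
  have re_mul_comm : ∀ a b : ℍ[ℝ], (a * b).re = (b * a).re := fun a b => by simp; ring
  rw [← mul_inv_cancel_right₀ hv m, ← h.eq, re_mul_comm, inv_mul_cancel_left₀ hv]

lemma semiconjBy_add_sub_iff {v a b : ℍ[ℝ]} (hv : v ≠ 0) :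
    SemiconjBy v (a + b) (a - b) ↔
      b.re = 0 ∧ inner ℝ v.im b = 0 ∧ v.re • b = -cross v.im a.im := by
  have key (hb : b.re = 0) : SemiconjBy v (a + b) (a - b) ↔
      v.re • b + cross v.im a.im = ((inner ℝ v.im b : ℝ) : ℍ[ℝ]) := by
    have hsum : v * (a + b) - (a - b) * v =
        (2 : ℝ) • (v.re • b + cross v.im a.im - ((inner ℝ v.im b : ℝ) : ℍ[ℝ])) := by
      rw [show v * (a + b) - (a - b) * v = (v * a - a * v) + (v * b + b * v) by noncomm_ring,
        mul_sub_mul_eq_cross, mul_add_mul_of_re_eq_zero v hb]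
      module
    rw [SemiconjBy, ← sub_eq_zero, hsum, smul_eq_zero_iff_right two_ne_zero, sub_eq_zero]
  constructor
  · intro h
    have hb : b.re = 0 := by
      have := re_eq_of_semiconjBy hv h
      rw [Quaternion.re_sub, Quaternion.re_add] at this
      linarith
    have heq := (key hb).1 h
    have hinner : inner ℝ v.im b = 0 := by
      simpa [hb, re_cross] using (congrArg QuaternionAlgebra.re heq).symm
    exact ⟨hb, hinner, eq_neg_of_add_eq_zero_left (by rw [heq, hinner, Quaternion.coe_zero])⟩
  · rintro ⟨hb, hinner, hcross⟩
    rw [key hb, hinner, hcross, neg_add_cancel, Quaternion.coe_zero]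

lemma exists_smul_of_commute {a b : ℍ[ℝ]} (ha0 : a ≠ 0) (ha : a.re = 0) (hb : b.re = 0)
    (h : Commute a b) : ∃ c : ℝ, c • a = b := by
  have hreal : a * b = ((a * b).re : ℍ[ℝ]) := by
    rw [← Quaternion.star_eq_self, star_mul, Quaternion.star_eq_neg.2 ha,
      Quaternion.star_eq_neg.2 hb, neg_mul_neg, h.eq]
  refine ⟨-((a * b).re * (Quaternion.normSq a)⁻¹), ?_⟩
  calc _ = ((a * b).re * (Quaternion.normSq a)⁻¹) • star a := by
        rw [Quaternion.star_eq_neg.2 ha, smul_neg, neg_smul]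
    _ = a⁻¹ * ((a * b).re : ℍ[ℝ]) := by
        rw [Quaternion.mul_coe_eq_smul, Quaternion.inv_def, smul_smul]
    _ = b := by rw [← hreal, inv_mul_cancel_left₀ ha0]

variable {V : Type*} [AddCommGroup V] [Module ℝ V]

lemma finrank_range_imₗ_le_one_iff {f : V →ₗ[ℝ] ℍ[ℝ]} :
    Module.finrank ℝ (LinearMap.range (imₗ ∘ₗ f)) ≤ 1 ↔ ∀ x y, Commute (f x) (f y) := by
  constructor
  · intro h x y
    obtain ⟨l, w, hf⟩ := finrank_range_le_one_iff_exists_smulRight.1 h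
    have him : ∀ z, (f z).im = l z • w := fun z => LinearMap.congr_fun hf z
    rw [← commute_im_im, him, him]
    exact ((Commute.refl w).smul_left _).smul_right _
  · intro h
    by_cases h0 : ∀ x, (f x).im = 0
    · have : imₗ ∘ₗ f = 0 := LinearMap.ext h0
      rw [this, LinearMap.range_zero, finrank_bot]
      exact zero_le_one
    push Not at h0
    obtain ⟨x, hx⟩ := h0
    refine finrank_le_one ⟨(f x).im, x, rfl⟩ ?_
    rintro ⟨_, y, rfl⟩
    obtain ⟨c, hc⟩ := exists_smul_of_commute hx (Quaternion.re_im _) (Quaternion.re_im _)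
      (commute_im_im.2 (h x y))
    exact ⟨c, Subtype.ext hc⟩

end Quaternions

section Cases

lemma finrank_range_comp_of_injective {K V W U : Type*} [Field K] [AddCommGroup V] [Module K V]
    [AddCommGroup W] [Module K W] [AddCommGroup U] [Module K U] (f : V →ₗ[K] W) {T : W →ₗ[K] U}
    (hT : Function.Injective T) :
    Module.finrank K (LinearMap.range (T ∘ₗ f)) = Module.finrank K (LinearMap.range f) := by
  rw [LinearMap.range_comp]
  exact (Submodule.equivMapOfInjective T hT _).finrank_eq.symm

lemma injective_sub_smul_cross {T : ℍ[ℝ] →ₗ[ℝ] ℍ[ℝ]} {v : ℍ[ℝ]} {r : ℝ}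
    (hT : ∀ a, T a = a - r • cross v a) : Function.Injective T := by
  refine (injective_iff_map_eq_zero T).2 fun a ha => ?_
  have hfix : a = r • cross v a := by rwa [hT, sub_eq_zero] at ha
  rw [← inner_self_eq_zero (𝕜 := ℝ)]
  nth_rewrite 2 [hfix]
  rw [inner_smul_right, inner_cross_right, mul_zero]

lemma exists_linearMap_sub_smul_cross (v : ℍ[ℝ]) (r : ℝ) :
    ∃ T : ℍ[ℝ] →ₗ[ℝ] ℍ[ℝ], ∀ a, T a = a - r • cross v a := by
  refine ⟨LinearMap.id - (r / 2) • (LinearMap.mulLeft ℝ v - LinearMap.mulRight ℝ v), fun a => ?_⟩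
  simp only [LinearMap.sub_apply, LinearMap.smul_apply, LinearMap.id_apply,
    LinearMap.mulLeft_apply, LinearMap.mulRight_apply, mul_sub_mul_eq_cross, smul_smul]
  rw [div_mul_cancel₀ r two_ne_zero]
  rfl

lemma exists_orthogonal_unit_combination (n : ℍ[ℝ]) (hn : ‖n‖ = 1) {u : ℍ[ℝ]} (hu : u.re = 0)
    (hnre : n.re = 0) : ∃ ν : ℍ[ℝ], ν.re = 0 ∧ ‖ν‖ = 1 ∧ inner ℝ n ν = 0 ∧
      ∃ s t : ℝ, u = s • n + t • ν := by
  let f : ℍ[ℝ] →ₗ[ℝ] ℝ × ℝ := (innerₗ ℍ[ℝ] 1).prod (innerₗ ℍ[ℝ] n)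
  have mem_ker {w : ℍ[ℝ]} : w ∈ LinearMap.ker f ↔ w.re = 0 ∧ inner ℝ n w = 0 := by
    simp [f, innerₗ_apply_apply, inner_one_left]
  have : Nontrivial (LinearMap.ker f) := (Submodule.nontrivial_iff_ne_bot).2
    (LinearMap.ker_ne_bot_of_finrank_lt (by simp [Quaternion.finrank_eq_four]))
  have hw : u - (inner ℝ n u : ℝ) • n ∈ LinearMap.ker f := mem_ker.2
    ⟨by simp [hu, hnre], by
      rw [inner_sub_right, inner_smul_right, real_inner_self_eq_norm_sq, hn]; ring⟩
  obtain ⟨⟨ν, hν⟩, hnorm, t, ht⟩ := exists_norm_eq_one_smul (⟨_, hw⟩ : LinearMap.ker f)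
  obtain ⟨hre, hperp⟩ := mem_ker.1 hν
  exact ⟨ν, hre, hnorm, hperp, inner ℝ n u, t,
    (sub_eq_iff_eq_add'.1 (congrArg Subtype.val ht))⟩

variable {E : Type*} [NormedAddCommGroup E] [InnerProductSpace ℝ E]
variable {ε : ℝ} {h₁ : ℍ[ℝ]} {h₃ h₄ : E →ₗ[ℝ] ℍ[ℝ]}

lemma firstCase_iff (hε : ε * ε = 1) (hre : h₁.re ≠ 0) :
    ((∀ x, SemiconjBy h₁ (h₃ x + ε • h₄ x) (h₃ x - ε • h₄ x)) ∧
      ∀ x y, Commute (h₃ x + ε • h₄ x) (h₃ y + ε • h₄ y)) ↔ FirstCase ε h₁ h₃ h₄ := by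
  have h0 : h₁ ≠ 0 := by rintro rfl; exact hre rfl
  have hsemi (x : E) : SemiconjBy h₁ (h₃ x + ε • h₄ x) (h₃ x - ε • h₄ x) ↔
      h₄ x = -(ε / h₁.re) • cross h₁.im (h₃ x).im := by
    have hcoef : (h₁.re * ε)⁻¹ = ε / h₁.re := by
      rw [mul_inv, inv_eq_of_mul_eq_one_left hε, inv_mul_eq_div]
    have hsolve : h₁.re • ε • h₄ x = -cross h₁.im (h₃ x).im ↔
        h₄ x = -(ε / h₁.re) • cross h₁.im (h₃ x).im := by
      rw [smul_smul, ← eq_inv_smul_iff₀ (mul_ne_zero hre (left_ne_zero_of_mul_eq_one hε)),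
        smul_neg, ← neg_smul, hcoef]
    rw [semiconjBy_add_sub_iff h0, hsolve]
    refine ⟨fun h => h.2.2, fun h => ⟨?_, ?_, h⟩⟩
    · simp [h, re_cross]
    · rw [h, inner_smul_right, inner_smul_right, inner_cross_left, mul_zero, mul_zero]
  rw [forall_congr' hsemi, FirstCase, and_iff_right hre, and_comm]
  refine and_congr_left fun h => ?_
  obtain ⟨T, hT⟩ := exists_linearMap_sub_smul_cross h₁.im h₁.re⁻¹
  have hcomp : imₗ ∘ₗ (h₃ + ε • h₄) = T ∘ₗ imₗ ∘ₗ h₃ := by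
    ext1 x
    have hsmul : ε • h₄ x = -(h₁.re⁻¹ • cross h₁.im (h₃ x).im) := by
      rw [h x, smul_smul, ← neg_smul]
      congr 1
      rw [mul_neg, ← mul_div_assoc, hε, one_div]
    have him : (cross h₁.im (h₃ x).im).im = cross h₁.im (h₃ x).im := rfl
    change (h₃ x + ε • h₄ x).im = T (h₃ x).im
    rw [hT, hsmul, Quaternion.im_add, Quaternion.im_neg, Quaternion.im_smul, him, sub_eq_add_neg]
  rw [← finrank_range_comp_of_injective _ (injective_sub_smul_cross hT), ← hcomp,
    finrank_range_imₗ_le_one_iff]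
  rfl

lemma cross_eq_zero_iff_exists {n a : ℍ[ℝ]} (hn : n ≠ 0) (hre : n.re = 0) :
    cross n a.im = 0 ↔ ∃ c : ℝ, a.im = c • n := by
  have him : n.im = n := by simpa [hre] using Quaternion.re_add_im n
  rw [← him, ← commute_iff_cross_eq_zero (b := a), ← commute_im_im, him]
  constructor
  · intro h
    obtain ⟨c, hc⟩ := exists_smul_of_commute hn hre (Quaternion.re_im a) h
    exact ⟨c, hc.symm⟩
  · rintro ⟨c, hc⟩
    rw [hc]
    exact (Commute.refl n).smul_right c

lemma semiconjBy_add_sub_iff_of_re_eq_zero (hε : ε ≠ 0) {v : ℍ[ℝ]} (hv : v ≠ 0) (hre : v.re = 0)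
    {a b : ℍ[ℝ]} : SemiconjBy v (a + ε • b) (a - ε • b) ↔
      b.re = 0 ∧ inner ℝ v b = 0 ∧ ∃ c : ℝ, a.im = c • v := by
  have him : v.im = v := by simpa [hre] using Quaternion.re_add_im v
  rw [semiconjBy_add_sub_iff hv, him, ← cross_eq_zero_iff_exists hv hre, hre, zero_smul,
    inner_smul_right]
  simp [hε, eq_comm]

lemma exists_orthogonal_unit_decomposition {n : ℍ[ℝ]} (hn : ‖n‖ = 1) (hnre : n.re = 0)
    {f g : E →ₗ[ℝ] ℍ[ℝ]} (hf : ∀ x, ∃ c : ℝ, (f x).im = c • n)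
    (hg : ∀ x, (g x).re = 0 ∧ inner ℝ n (g x) = 0)
    (hcomm : ∀ x y, Commute (f x + g x) (f y + g y)) :
    ∃ (l : E →ₗ[ℝ] ℝ) (s t : ℝ) (ν : ℍ[ℝ]), ν.re = 0 ∧ ‖ν‖ = 1 ∧ inner ℝ n ν = 0 ∧
      (∀ x, (f x).im = (s * l x) • n) ∧ ∀ x, g x = (t * l x) • ν := by
  obtain ⟨l, u, hlu⟩ := finrank_range_le_one_iff_exists_smulRight.1
    (finrank_range_imₗ_le_one_iff (f := f + g).2 hcomm)
  obtain ⟨ν, hνre, hν, hperp, s, t, hu⟩ := exists_orthogonal_unit_combination n hn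
    (Quaternion.re_im u) hnre
  have hsum (x : E) : (f x).im + g x = (s * l x) • n + (t * l x) • ν := by
    have him : (g x).im = g x := by simpa [(hg x).1] using Quaternion.re_add_im (g x)
    have h : (f x + g x).im = l x • u := LinearMap.congr_fun hlu x
    have h' := congrArg Quaternion.im h
    rw [Quaternion.im_idem, Quaternion.im_add, him, Quaternion.im_smul, hu] at h'
    rw [h']
    module
  have hfx (x : E) : (f x).im = (s * l x) • n := by
    obtain ⟨c, hc⟩ := hf x
    have h := congrArg (inner ℝ n) (hsum x)
    simp only [hc, inner_add_right, inner_smul_right, (hg x).2, hperp,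
      real_inner_self_eq_norm_sq, hn] at h
    rw [hc, show c = s * l x by linarith]
  exact ⟨l, s, t, ν, hνre, hν, hperp, hfx, fun x => add_left_cancel ((hfx x) ▸ hsum x)⟩

lemma secondCase_of_semiconjBy (hε : ε * ε = 1) (hre : h₁.re = 0) (him : h₁.im ≠ 0)
    (hsemi : ∀ x, SemiconjBy h₁ (h₃ x + ε • h₄ x) (h₃ x - ε • h₄ x))
    (hcomm : ∀ x y, Commute (h₃ x + ε • h₄ x) (h₃ y + ε • h₄ y)) : SecondCase h₁ h₃ h₄ := by
  have him' : h₁.im = h₁ := by simpa [hre] using Quaternion.re_add_im h₁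
  have h0 : h₁ ≠ 0 := him' ▸ him
  have hnorm : ‖h₁‖ ≠ 0 := norm_ne_zero_iff.2 h0
  have hcond (x : E) := (semiconjBy_add_sub_iff_of_re_eq_zero
    (left_ne_zero_of_mul_eq_one hε) h0 hre).1 (hsemi x)
  obtain ⟨l, s, t, ν, hνre, hν, hperp, hl₃, hl₄⟩ :=
    exists_orthogonal_unit_decomposition (n := ‖h₁‖⁻¹ • h₁) (f := h₃) (g := ε • h₄)
      (by rw [norm_smul, norm_inv, norm_norm, inv_mul_cancel₀ hnorm]) (by simp [hre])
      (fun x => by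
        obtain ⟨c, hc⟩ := (hcond x).2.2
        exact ⟨c * ‖h₁‖, by rw [hc, smul_smul, mul_assoc, mul_inv_cancel₀ hnorm, mul_one]⟩)
      (fun x => by
        simp [(hcond x).1, (hcond x).2.1, real_inner_smul_left, inner_smul_right])
      hcomm
  have hperp' : inner ℝ h₁ ν = 0 := by
    simpa [real_inner_smul_left, hnorm, h0] using hperp
  refine ⟨hre, him, innerₗ ℍ[ℝ] 1 ∘ₗ h₃, s • l, (ε * t) • l, ν, hνre, hν, him'.symm ▸ hperp',
    fun x => ?_, fun x => ?_, exists_smul_and_smul_iff_ker_eq.1 ⟨l, s, ε * t, rfl, rfl⟩⟩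
  · rw [him', LinearMap.comp_apply, innerₗ_apply_apply, inner_one_left, LinearMap.smul_apply,
      smul_eq_mul, ← hl₃, Quaternion.re_add_im]
  · rw [LinearMap.smul_apply, smul_eq_mul, mul_assoc, ← smul_smul, ← hl₄, LinearMap.smul_apply,
      smul_smul, hε, one_smul]

lemma SecondCase.semiconjBy (hε : ε ≠ 0) (h : SecondCase h₁ h₃ h₄) (x : E) :
    SemiconjBy h₁ (h₃ x + ε • h₄ x) (h₃ x - ε • h₄ x) := by
  obtain ⟨hre, him, r, c, μ, ν, hν, -, hperp, h₃_eq, h₄_eq, -⟩ := h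
  have him' : h₁.im = h₁ := by simpa [hre] using Quaternion.re_add_im h₁
  refine (semiconjBy_add_sub_iff_of_re_eq_zero hε (him' ▸ him) hre).2 ⟨?_, ?_, c x * ‖h₁‖⁻¹, ?_⟩
  · simp [h₄_eq, hν]
  · rw [h₄_eq, inner_smul_right, ← him', hperp, mul_zero]
  · simp [h₃_eq, him', smul_smul]

lemma SecondCase.commute (h : SecondCase h₁ h₃ h₄) (x y : E) :
    Commute (h₃ x + ε • h₄ x) (h₃ y + ε • h₄ y) := by
  obtain ⟨-, -, r, c, μ, ν, -, -, -, h₃_eq, h₄_eq, hker⟩ := h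
  obtain ⟨l, s, t, rfl, rfl⟩ := exists_smul_and_smul_iff_ker_eq.2 hker
  have him (z : E) : (h₃ z + ε • h₄ z).im = l z • (s • ‖h₁.im‖⁻¹ • h₁.im + (ε * t) • ν.im) := by
    simp only [h₃_eq, h₄_eq, Quaternion.im_add, Quaternion.im_smul, Quaternion.im_coe,
      Quaternion.im_idem, LinearMap.smul_apply, smul_eq_mul]
    module
  rw [← commute_im_im, him, him]
  exact ((Commute.refl _).smul_left _).smul_right _

theorem firstCase_or_secondCase_iff (hε : ε * ε = 1) :
    (h₁ ≠ 0 ∧ (∀ x, SemiconjBy h₁ (h₃ x + ε • h₄ x) (h₃ x - ε • h₄ x)) ∧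
      ∀ x y, Commute (h₃ x + ε • h₄ x) (h₃ y + ε • h₄ y)) ↔
    FirstCase ε h₁ h₃ h₄ ∨ SecondCase h₁ h₃ h₄ := by
  constructor
  · rintro ⟨h0, hsemi, hcomm⟩
    by_cases hre : h₁.re = 0
    · have him : h₁.im ≠ 0 := fun h => h0 (by rw [← Quaternion.re_add_im h₁, hre, h]; simp)
      exact .inr (secondCase_of_semiconjBy hε hre him hsemi hcomm)
    · exact .inl ((firstCase_iff hε hre).1 ⟨hsemi, hcomm⟩)
  · rintro (h | h)
    · exact ⟨fun h0 => h.1 (by simp [h0]), (firstCase_iff hε h.1).2 h⟩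
    · exact ⟨fun h0 => h.2.1 (by simp [h0]), h.semiconjBy (left_ne_zero_of_mul_eq_one hε),
        h.commute⟩

end Cases

section CliffordTriple

variable {E : Type*} [NormedAddCommGroup E] [InnerProductSpace ℝ E]
  {R : Type*} [Ring R] [Algebra ℝ R] {K : Type*} [Ring K] [Algebra ℝ K]

/-- Clifford multiplication `c`, a volume element `ω` that anticommutes with it, and an
identification `κ` of the algebra `K` with the commutant of Clifford multiplication. -/
structure IsCliffordTriple (c : E →ₗ[ℝ] R) (ω : R) (κ : K →ₐ[ℝ] R) : Prop where
  mul_add_mul : ∀ x y, c x * c y + c y * c x = (2 * inner ℝ x y : ℝ) • 1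
  omega_mul : ∀ x, ω * c x = -(c x * ω)
  omega_mul_self : ω * ω = 1
  mul_map : ∀ x h, c x * κ h = κ h * c x
  omega_mul_map : ∀ h, ω * κ h = κ h * ω
  injective : Function.Injective κ
  exists_of_commute : ∀ A, (∀ x, Commute (c x) A) → ∃ h, κ h = A

/-- The linear map `x ↦ (h₃(x) + h₁ x + h₂ x ω + h₄(x) ω) / 2`. For `h₂ = ±h₁`, this is the lower
diagonal block of a spin representation, and the upper one is obtained by changing the signs of
Clifford multiplication and of `ω`. -/
noncomputable def diagonalPart (c : E →ₗ[ℝ] R) (ω : R) (κ : K →ₐ[ℝ] R) (h₁ h₂ : K)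
    (h₃ h₄ : E →ₗ[ℝ] K) : E →ₗ[ℝ] R :=
  (1 / 2 : ℝ) • (κ.toLinearMap ∘ₗ h₃ + LinearMap.mulLeft ℝ (κ h₁) ∘ₗ c +
    LinearMap.mulRight ℝ ω ∘ₗ LinearMap.mulLeft ℝ (κ h₂) ∘ₗ c +
    LinearMap.mulRight ℝ ω ∘ₗ κ.toLinearMap ∘ₗ h₄)

lemma diagonalPart_apply (c : E →ₗ[ℝ] R) (ω : R) (κ : K →ₐ[ℝ] R) (h₁ h₂ : K)
    (h₃ h₄ : E →ₗ[ℝ] K) (x : E) :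
    diagonalPart c ω κ h₁ h₂ h₃ h₄ x = (1 / 2 : ℝ) •
      (κ (h₃ x) + κ h₁ * c x + κ h₂ * c x * ω + κ (h₄ x) * ω) := rfl

variable {c : E →ₗ[ℝ] R} {ω : R} {κ : K →ₐ[ℝ] R}

lemma semiconjBy_of_orthogonal {y : E} (hy : ‖y‖ = 1) {A B : R} (h : SemiconjBy (c y) A B)
    (horth : ∀ z, inner ℝ z y = (0 : ℝ) → SemiconjBy (c z) A B) (z : E) :
    SemiconjBy (c z) A B := by
  have hz := horth (z - (inner ℝ z y : ℝ) • y) (by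
    rw [inner_sub_left, real_inner_smul_left, real_inner_self_eq_norm_sq, hy]; ring)
  have hsum : c z = c (z - (inner ℝ z y : ℝ) • y) + (inner ℝ z y : ℝ) • c y := by
    rw [map_sub, map_smul, sub_add_cancel]
  rw [hsum]
  exact hz.add_left (by rw [SemiconjBy, smul_mul_assoc, h.eq, mul_smul_comm])

namespace IsCliffordTriple

lemma neg (T : IsCliffordTriple c ω κ) : IsCliffordTriple (-c) (-ω) κ where
  mul_add_mul x y := by simp [T.mul_add_mul]
  omega_mul x := by simp [T.omega_mul]
  omega_mul_self := by simp [T.omega_mul_self]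
  mul_map x h := by simp [T.mul_map]
  omega_mul_map h := by simp [T.omega_mul_map]
  injective := T.injective
  exists_of_commute A hA := T.exists_of_commute A fun x => by simpa using (hA x).neg_left

variable (T : IsCliffordTriple c ω κ)
include T

lemma omega_mul_mul (x : E) (X : R) : ω * (c x * X) = -(c x * (ω * X)) := by
  rw [← mul_assoc, T.omega_mul, neg_mul, mul_assoc]

lemma mul_map_mul (x : E) (h : K) (X : R) : c x * (κ h * X) = κ h * (c x * X) := by
  rw [← mul_assoc, T.mul_map, mul_assoc]

lemma omega_mul_map_mul (h : K) (X : R) : ω * (κ h * X) = κ h * (ω * X) := by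
  rw [← mul_assoc, T.omega_mul_map, mul_assoc]

lemma mul_self (y : E) : c y * c y = (inner ℝ y y : ℝ) • 1 := by
  have h := T.mul_add_mul y y
  rw [← two_smul ℝ, mul_smul] at h
  exact smul_right_injective R (two_ne_zero (α := ℝ)) h

lemma mul_self_of_norm_eq_one {y : E} (hy : ‖y‖ = 1) : c y * c y = 1 := by
  rw [T.mul_self, real_inner_self_eq_norm_sq, hy]; simp

lemma semiconjBy_symm {z : E} {A B : R} (h : SemiconjBy (c z) A B) : SemiconjBy (c z) B A := by
  obtain rfl | hz := eq_or_ne z 0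
  · rw [map_zero]
    exact .zero_left B A
  refine smul_right_injective R (inner_self_ne_zero (𝕜 := ℝ).2 hz) ?_
  calc (inner ℝ z z : ℝ) • (c z * B) = c z * (B * c z) * c z := by
        rw [mul_assoc, mul_assoc, T.mul_self, mul_smul_comm, mul_smul_comm, mul_one]
    _ = c z * c z * (A * c z) := by rw [← h.eq, mul_assoc, mul_assoc, mul_assoc]
    _ = (inner ℝ z z : ℝ) • (A * c z) := by rw [T.mul_self, smul_mul_assoc, one_mul]

lemma exists_eq_add_eq_sub_of_semiconjBy {A B : R} (h : ∀ z, SemiconjBy (c z) A B) :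
    ∃ k l, A = κ k + κ l * ω ∧ B = κ k - κ l * ω := by
  have hAB (z : E) : c z * A = B * c z := h z
  have hBA (z : E) : c z * B = A * c z := T.semiconjBy_symm (h z)
  obtain ⟨k, hk⟩ := T.exists_of_commute ((1 / 2 : ℝ) • (A + B)) fun z => by
    rw [commute_iff_eq, mul_smul_comm, smul_mul_assoc, mul_add, add_mul, hAB, hBA, add_comm]
  obtain ⟨l, hl⟩ := T.exists_of_commute ((1 / 2 : ℝ) • ((A - B) * ω)) fun z => by
    rw [commute_iff_eq, mul_smul_comm, smul_mul_assoc, mul_assoc, T.omega_mul, mul_neg, ← mul_assoc,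
      ← mul_assoc, mul_sub, hAB, hBA, ← neg_mul, ← sub_mul, ← neg_mul, neg_sub]
  have hlω : κ l * ω = (1 / 2 : ℝ) • (A - B) := by
    rw [hl, smul_mul_assoc, mul_assoc, T.omega_mul_self, mul_one]
  refine ⟨k, l, ?_, ?_⟩ <;>
  · rw [hk, hlω]
    module

lemma exists_linearMap_of_semiconjBy {V : Type*} [AddCommGroup V] [Module ℝ V] {A B : V →ₗ[ℝ] R}
    (h : ∀ v z, SemiconjBy (c z) (A v) (B v)) :
    ∃ f g : V →ₗ[ℝ] K, ∀ v, A v = κ (f v) + κ (g v) * ω ∧ B v = κ (f v) - κ (g v) * ω := by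
  choose f g hA hB using fun v => T.exists_eq_add_eq_sub_of_semiconjBy (h v)
  have hf (v : V) : κ (f v) = (1 / 2 : ℝ) • (A v + B v) := by
    rw [hA, hB]; module
  have hg (v : V) : κ (g v) = (1 / 2 : ℝ) • ((A v - B v) * ω) := by
    rw [hA, hB, add_sub_sub_cancel, add_mul, mul_assoc, T.omega_mul_self, mul_one]; module
  refine ⟨⟨⟨f, fun v w => T.injective ?_⟩, fun r v => T.injective ?_⟩,
    ⟨⟨g, fun v w => T.injective ?_⟩, fun r v => T.injective ?_⟩, fun v => ⟨hA v, hB v⟩⟩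
  · simp only [map_add, hf]; module
  · simp only [map_smul, hf, RingHom.id_apply]; module
  · simp only [map_add, hg, add_mul, sub_mul]; module
  · simp only [map_smul, hg, sub_mul, smul_mul_assoc, RingHom.id_apply]; module

lemma add_mul_omega_eq_zero_iff [Nontrivial E] {k l : K} :
    κ k + κ l * ω = 0 ↔ k = 0 ∧ l = 0 := by
  refine ⟨fun h => ?_, fun ⟨hk, hl⟩ => by rw [hk, hl, map_zero, zero_mul, add_zero]⟩
  obtain ⟨y, hy⟩ := exists_norm_eq E (zero_le_one' ℝ)
  have hconj : κ k - κ l * ω = 0 :=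
    calc κ k - κ l * ω = c y * (κ k + κ l * ω) * c y := by
          simp only [mul_add, add_mul, mul_assoc, T.mul_map_mul, T.omega_mul, mul_neg]
          rw [← mul_assoc (c y), T.mul_self_of_norm_eq_one hy, mul_one, one_mul, sub_eq_add_neg]
      _ = 0 := by rw [h, mul_zero, zero_mul]
  have hk : κ k = 0 :=
    calc κ k = (1 / 2 : ℝ) • (κ k + κ l * ω) + (1 / 2 : ℝ) • (κ k - κ l * ω) := by module
      _ = 0 := by rw [h, hconj, smul_zero, add_zero]
  have hl : κ l * ω = 0 := by rwa [hk, zero_add] at h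
  refine ⟨T.injective (by rw [hk, map_zero]), T.injective ?_⟩
  rw [map_zero, ← mul_one (κ l), ← T.omega_mul_self, ← mul_assoc, hl, zero_mul]

end IsCliffordTriple

end CliffordTriple

section DiagonalPart

variable {E : Type*} [NormedAddCommGroup E] [InnerProductSpace ℝ E]
  {R : Type*} [Ring R] [Algebra ℝ R] {K : Type*} [Ring K] [Algebra ℝ K]
  {c : E →ₗ[ℝ] R} {ω : R} {κ : K →ₐ[ℝ] R}

/-- The conditions under which `a`, `d` are the diagonal blocks and `√2 Q` is the charge of a
representation of the Heisenberg algebra by upper triangular block matrices. -/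
structure IsDiagonalPair (c a d : E →ₗ[ℝ] R) (Q : R) : Prop where
  mul_sub_mul : ∀ z y, c z * d y - a y * c z = (inner ℝ z y : ℝ) • Q
  semiconjBy : ∀ y, SemiconjBy Q (d y) (a y)
  commute_left : ∀ x y, Commute (a x) (a y)
  commute_right : ∀ x y, Commute (d x) (d y)

namespace IsCliffordTriple

lemma semiconjBy_charge (T : IsCliffordTriple c ω κ) {a d : E →ₗ[ℝ] R} {Q : R}
    (H : ∀ z y, c z * d y - a y * c z = (inner ℝ z y : ℝ) • Q) {y : E} (hy : ‖y‖ = 1) (z : E) :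
    SemiconjBy (c z) Q (c y * Q * c y) := by
  have hyy := T.mul_self_of_norm_eq_one hy
  have hQ : c y * d y - a y * c y = Q := by
    rw [H, real_inner_self_eq_norm_sq, hy, one_pow, one_smul]
  have hconj : c y * Q * c y = d y * c y - c y * a y := by
    rw [← hQ, mul_sub, sub_mul, ← mul_assoc, hyy, one_mul, ← mul_assoc, mul_assoc _ (c y) (c y),
      hyy, mul_one]
  refine semiconjBy_of_orthogonal hy ?_ (fun w hw => ?_) z
  · rw [SemiconjBy, mul_assoc _ (c y) (c y), hyy, mul_one]
  have hwd : c w * d y = a y * c w := by rw [← sub_eq_zero, H, hw, zero_smul]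
  have hwa : c w * a y = d y * c w := T.semiconjBy_symm hwd
  have hwy : c w * c y = -(c y * c w) := by
    rw [eq_neg_iff_add_eq_zero, T.mul_add_mul, hw, mul_zero, zero_smul]
  calc c w * Q = c w * c y * d y - c w * a y * c y := by
        rw [← hQ, mul_sub, mul_assoc, mul_assoc]
    _ = d y * (c y * c w) - c y * (c w * d y) := by
        rw [hwa, hwy, mul_assoc, hwy]; noncomm_ring
    _ = c y * Q * c y * c w := by rw [hconj, hwd]; noncomm_ring

variable {h₁ h₂ : K} {h₃ h₄ : E →ₗ[ℝ] K}

lemma mul_diagonalPart_sub (T : IsCliffordTriple c ω κ) (z y : E) :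
    c z * diagonalPart c ω κ h₁ h₂ h₃ h₄ y - diagonalPart (-c) (-ω) κ h₁ h₂ h₃ h₄ y * c z =
      (inner ℝ z y : ℝ) • (κ h₁ + κ h₂ * ω) :=
  calc
    _ = (1 / 2 : ℝ) •
          (κ h₁ * (c z * c y + c y * c z) + κ h₂ * ((c z * c y + c y * c z) * ω)) := by
      simp only [diagonalPart_apply, LinearMap.neg_apply, mul_smul_comm, smul_mul_assoc, mul_add,
        add_mul, mul_assoc, T.mul_map_mul, T.mul_map, T.omega_mul, mul_neg, neg_mul, neg_neg]
      module
    _ = _ := by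
      rw [T.mul_add_mul]
      simp only [mul_smul_comm, smul_mul_assoc, mul_one, one_mul]
      module

lemma exists_eq_diagonalPart [Nontrivial E] (T : IsCliffordTriple c ω κ) {a d : E →ₗ[ℝ] R} {Q : R}
    (H : ∀ z y, c z * d y - a y * c z = (inner ℝ z y : ℝ) • Q) :
    ∃ (h₁ h₂ : K) (h₃ h₄ : E →ₗ[ℝ] K), Q = κ h₁ + κ h₂ * ω ∧
      a = diagonalPart (-c) (-ω) κ h₁ h₂ h₃ h₄ ∧ d = diagonalPart c ω κ h₁ h₂ h₃ h₄ := by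
  obtain ⟨y, hy⟩ := exists_norm_eq E (zero_le_one' ℝ)
  obtain ⟨h₁, h₂, hQ, -⟩ := T.exists_eq_add_eq_sub_of_semiconjBy (T.semiconjBy_charge H hy)
  obtain ⟨f, g, hfg⟩ := T.exists_linearMap_of_semiconjBy
    (A := d - diagonalPart c ω κ h₁ h₂ 0 0) (B := a - diagonalPart (-c) (-ω) κ h₁ h₂ 0 0)
    fun x z => by
      have h := (H z x).trans ((congrArg _ hQ).trans
        (T.mul_diagonalPart_sub (h₃ := 0) (h₄ := 0) z x).symm)
      rw [SemiconjBy, LinearMap.sub_apply, LinearMap.sub_apply, mul_sub, sub_mul]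
      exact sub_eq_sub_iff_sub_eq_sub.1 h
  refine ⟨h₁, h₂, (2 : ℝ) • f, (2 : ℝ) • g, hQ, ?_, ?_⟩ <;> ext x
  · rw [← sub_add_cancel (a x) (diagonalPart (-c) (-ω) κ h₁ h₂ 0 0 x), ← LinearMap.sub_apply,
      (hfg x).2]
    simp only [diagonalPart_apply, LinearMap.zero_apply, map_zero, LinearMap.neg_apply, mul_neg,
      zero_add, neg_mul, neg_neg, zero_mul, neg_zero, add_zero, LinearMap.smul_apply, map_smul,
      smul_mul_assoc]
    module
  · rw [← sub_add_cancel (d x) (diagonalPart c ω κ h₁ h₂ 0 0 x), ← LinearMap.sub_apply, (hfg x).1]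
    simp only [diagonalPart_apply, LinearMap.zero_apply, map_zero, zero_add, zero_mul, add_zero,
      LinearMap.smul_apply, map_smul, smul_mul_assoc]
    module

end IsCliffordTriple

end DiagonalPart

lemma commute_of_semiconjBy {M : Type*} [Semigroup M] [Zero M] [IsRightCancelMulZero M]
    {v p q p' q' : M} (hv : v ≠ 0) (hq : SemiconjBy v p q) (hq' : SemiconjBy v p' q')
    (h : Commute p p') : Commute q q' := by
  refine mul_right_cancel₀ hv ?_
  rw [← (hq.mul_right hq').eq, h.eq, (hq'.mul_right hq).eq]

section DiagonalPart

variable {E : Type*} [NormedAddCommGroup E] [InnerProductSpace ℝ E]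
  {R : Type*} [Ring R] [Algebra ℝ R] {K : Type*} [Ring K] [Algebra ℝ K]
  {c : E →ₗ[ℝ] R} {ω : R} {κ : K →ₐ[ℝ] R} {h₁ h₂ : K} {h₃ h₄ : E →ₗ[ℝ] K} {ε : ℝ}

namespace IsCliffordTriple

variable (T : IsCliffordTriple c ω κ)
include T

lemma eq_zero_of_even_add_odd {u v : R} (hu : ω * u = u * ω) (hv : ω * v = -(v * ω))
    (h : u + v = 0) : u = 0 ∧ v = 0 := by
  have huv : u - v = 0 :=
    calc u - v = (u - v) * (ω * ω) := by rw [T.omega_mul_self, mul_one]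
      _ = ω * (u + v) * ω := by
        rw [mul_add, hu, hv, ← mul_assoc, sub_mul, sub_eq_add_neg]
      _ = 0 := by rw [h, mul_zero, zero_mul]
  have h0 : u = 0 :=
    calc u = (1 / 2 : ℝ) • (u + v) + (1 / 2 : ℝ) • (u - v) := by module
      _ = 0 := by rw [h, huv, smul_zero, add_zero]
  exact ⟨h0, by rwa [h0, zero_add] at h⟩

lemma charge_mul_diagonalPart_sub (y : E) :
    (2 : ℝ) • ((κ h₁ + κ h₂ * ω) * diagonalPart c ω κ h₁ h₂ h₃ h₄ y -
      diagonalPart (-c) (-ω) κ h₁ h₂ h₃ h₄ y * (κ h₁ + κ h₂ * ω)) =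
      (κ (h₁ * h₃ y + h₂ * h₄ y - (h₃ y * h₁ - h₄ y * h₂)) +
        κ (h₁ * h₄ y + h₂ * h₃ y - (h₃ y * h₂ - h₄ y * h₁)) * ω) +
      (2 : ℝ) • ((κ (h₁ * h₁ - h₂ * h₂) + κ (h₂ * h₁ - h₁ * h₂) * ω) * c y) := by
  simp only [diagonalPart_apply, LinearMap.neg_apply, mul_smul_comm, smul_mul_assoc, mul_add,
    add_mul, neg_mul, mul_assoc, T.mul_map_mul, T.mul_map, T.omega_mul, T.omega_mul_mul,
    T.omega_mul_map, T.omega_mul_map_mul, T.omega_mul_self, mul_neg, neg_neg, map_add, map_sub,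
    map_mul, mul_one, sub_mul]
  module

lemma forall_semiconjBy_diagonalPart_iff [Nontrivial E] :
    (∀ y, SemiconjBy (κ h₁ + κ h₂ * ω) (diagonalPart c ω κ h₁ h₂ h₃ h₄ y)
      (diagonalPart (-c) (-ω) κ h₁ h₂ h₃ h₄ y)) ↔
    (h₁ * h₁ = h₂ * h₂ ∧ h₂ * h₁ = h₁ * h₂) ∧ ∀ y,
      h₁ * h₃ y + h₂ * h₄ y = h₃ y * h₁ - h₄ y * h₂ ∧
      h₁ * h₄ y + h₂ * h₃ y = h₃ y * h₂ - h₄ y * h₁ := by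
  have heven (y : E) := T.add_mul_omega_eq_zero_iff
    (k := h₁ * h₃ y + h₂ * h₄ y - (h₃ y * h₁ - h₄ y * h₂))
    (l := h₁ * h₄ y + h₂ * h₃ y - (h₃ y * h₂ - h₄ y * h₁))
  have hodd := T.add_mul_omega_eq_zero_iff (k := h₁ * h₁ - h₂ * h₂) (l := h₂ * h₁ - h₁ * h₂)
  simp only [sub_eq_zero] at heven hodd
  constructor
  · intro h
    have hzero (y : E) := T.eq_zero_of_even_add_odd
      (by simp only [mul_add, add_mul, mul_assoc, T.omega_mul_map, T.omega_mul_map_mul])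
      (by
        simp only [mul_add, add_mul, mul_assoc, mul_smul_comm, smul_mul_assoc, T.omega_mul_map_mul,
          T.omega_mul, T.omega_mul_mul, T.omega_mul_self, mul_neg, neg_mul, mul_one]
        module)
      ((T.charge_mul_diagonalPart_sub (h₃ := h₃) (h₄ := h₄) y).symm.trans
        (by rw [(h y).eq, sub_self, smul_zero]))
    refine ⟨?_, fun y => (heven y).1 (hzero y).1⟩
    obtain ⟨y, hy⟩ := exists_norm_eq E (zero_le_one' ℝ)
    have hodd_mul := (smul_eq_zero.1 (hzero y).2).resolve_left two_ne_zero
    refine hodd.1 ?_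
    rw [← mul_one (_ + _), ← T.mul_self_of_norm_eq_one hy, ← mul_assoc, hodd_mul, zero_mul]
  · rintro ⟨h₁₂, h₃₄⟩ y
    have h := T.charge_mul_diagonalPart_sub (h₁ := h₁) (h₂ := h₂) (h₃ := h₃) (h₄ := h₄) y
    rw [(heven y).2 (h₃₄ y), hodd.2 h₁₂, zero_mul, smul_zero, add_zero] at h
    exact sub_eq_zero.1 ((smul_eq_zero.1 h).resolve_left two_ne_zero)

lemma forall_semiconjBy_diagonalPart_smul_iff [Nontrivial E] (hε : ε * ε = 1) :
    (∀ y, SemiconjBy (κ h₁ + κ (ε • h₁) * ω) (diagonalPart c ω κ h₁ (ε • h₁) h₃ h₄ y)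
      (diagonalPart (-c) (-ω) κ h₁ (ε • h₁) h₃ h₄ y)) ↔
    ∀ y, SemiconjBy h₁ (h₃ y + ε • h₄ y) (h₃ y - ε • h₄ y) := by
  rw [T.forall_semiconjBy_diagonalPart_iff, and_iff_right
    ⟨by rw [smul_mul_smul_comm, hε, one_smul], by rw [smul_mul_assoc, mul_smul_comm]⟩]
  refine forall_congr' fun y => ?_
  simp only [SemiconjBy, mul_add, sub_mul, smul_mul_assoc, mul_smul_comm]
  refine ⟨fun h => h.1, fun h => ⟨h, ?_⟩⟩
  calc h₁ * h₄ y + ε • (h₁ * h₃ y) = ε • (h₁ * h₃ y + ε • (h₁ * h₄ y)) := by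
        rw [smul_add, smul_smul, hε, one_smul, add_comm]
    _ = ε • (h₃ y * h₁) - h₄ y * h₁ := by rw [h, smul_sub, smul_smul, hε, one_smul]

lemma diagonalPart_commutator (hε : ε = 1 ∨ ε = -1) (x y : E) :
    (8 : ℝ) • (diagonalPart c ω κ h₁ (ε • h₁) h₃ h₄ x * diagonalPart c ω κ h₁ (ε • h₁) h₃ h₄ y -
      diagonalPart c ω κ h₁ (ε • h₁) h₃ h₄ y * diagonalPart c ω κ h₁ (ε • h₁) h₃ h₄ x) =
      κ (⁅h₃ x + ε • h₄ x, h₃ y + ε • h₄ y⁆ + ⁅h₃ x - ε • h₄ x, h₃ y - ε • h₄ y⁆) +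
      κ (ε • (⁅h₃ x + ε • h₄ x, h₃ y + ε • h₄ y⁆ - ⁅h₃ x - ε • h₄ x, h₃ y - ε • h₄ y⁆)) * ω +
      (2 : ℝ) • ((κ (h₁ * (h₃ y + ε • h₄ y) - (h₃ y - ε • h₄ y) * h₁) * c x -
        κ (h₁ * (h₃ x + ε • h₄ x) - (h₃ x - ε • h₄ x) * h₁) * c y) * (1 + ε • ω)) := by
  rcases hε with rfl | rfl <;>
  simp only [diagonalPart_apply, Ring.lie_def, mul_smul_comm, smul_mul_assoc, mul_add, add_mul,
    sub_mul, mul_sub, mul_assoc, T.mul_map_mul, T.mul_map, T.omega_mul, T.omega_mul_mul,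
    T.omega_mul_map, T.omega_mul_map_mul, T.omega_mul_self, mul_neg, map_add, map_sub, map_mul,
    map_smul, mul_one] <;>
  module

theorem commute_diagonalPart_iff [Nontrivial E] [NoZeroDivisors K] (hε : ε = 1 ∨ ε = -1)
    (h0 : h₁ ≠ 0) (hsemi : ∀ x, SemiconjBy h₁ (h₃ x + ε • h₄ x) (h₃ x - ε • h₄ x)) (x y : E) :
    Commute (diagonalPart c ω κ h₁ (ε • h₁) h₃ h₄ x) (diagonalPart c ω κ h₁ (ε • h₁) h₃ h₄ y) ↔
      Commute (h₃ x + ε • h₄ x) (h₃ y + ε • h₄ y) := by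
  have h := T.diagonalPart_commutator (h₁ := h₁) (h₃ := h₃) (h₄ := h₄) hε x y
  rw [(hsemi x).eq, (hsemi y).eq, sub_self, sub_self, map_zero, zero_mul, zero_mul, sub_self,
    zero_mul, smul_zero, add_zero] at h
  have hε0 : ε ≠ 0 := by rcases hε with rfl | rfl <;> norm_num
  rw [commute_iff_eq, ← sub_eq_zero, ← smul_eq_zero_iff_right (by norm_num : (8 : ℝ) ≠ 0), h,
    T.add_mul_omega_eq_zero_iff, smul_eq_zero_iff_right hε0, sub_eq_zero]
  refine ⟨fun ⟨hadd, heq⟩ => ?_, fun hcomm => ?_⟩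
  · rw [← heq, ← two_smul ℝ, smul_eq_zero_iff_right two_ne_zero] at hadd
    exact commute_iff_lie_eq.2 hadd
  · rw [commute_iff_lie_eq.1 hcomm, commute_iff_lie_eq.1
      (commute_of_semiconjBy h0 (hsemi x) (hsemi y) hcomm), add_zero]
    exact ⟨rfl, rfl⟩

variable {a d : E →ₗ[ℝ] R} {Q : R}

lemma isDiagonalPair_diagonalPart [Nontrivial E] [NoZeroDivisors K] (hε : ε = 1 ∨ ε = -1)
    (h0 : h₁ ≠ 0) (hsemi : ∀ x, SemiconjBy h₁ (h₃ x + ε • h₄ x) (h₃ x - ε • h₄ x))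
    (hcomm : ∀ x y, Commute (h₃ x + ε • h₄ x) (h₃ y + ε • h₄ y)) :
    IsDiagonalPair c (diagonalPart (-c) (-ω) κ h₁ (ε • h₁) h₃ h₄)
      (diagonalPart c ω κ h₁ (ε • h₁) h₃ h₄) (κ h₁ + κ (ε • h₁) * ω) where
  mul_sub_mul := T.mul_diagonalPart_sub
  semiconjBy := (T.forall_semiconjBy_diagonalPart_smul_iff (mul_self_eq_one_iff.2 hε)).2 hsemi
  commute_left x y := (T.neg.commute_diagonalPart_iff hε h0 hsemi x y).2 (hcomm x y)
  commute_right x y := (T.commute_diagonalPart_iff hε h0 hsemi x y).2 (hcomm x y)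

lemma exists_of_isDiagonalPair [Nontrivial E] [NoZeroDivisors K] (H : IsDiagonalPair c a d Q)
    (hQ : Q ≠ 0) :
    ∃ (ε : ℝ) (h₁ : K) (h₃ h₄ : E →ₗ[ℝ] K), (ε = 1 ∨ ε = -1) ∧
      (h₁ ≠ 0 ∧ (∀ x, SemiconjBy h₁ (h₃ x + ε • h₄ x) (h₃ x - ε • h₄ x)) ∧
        ∀ x y, Commute (h₃ x + ε • h₄ x) (h₃ y + ε • h₄ y)) ∧
      Q = κ h₁ + κ (ε • h₁) * ω ∧ a = diagonalPart (-c) (-ω) κ h₁ (ε • h₁) h₃ h₄ ∧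
      d = diagonalPart c ω κ h₁ (ε • h₁) h₃ h₄ := by
  obtain ⟨h₁, h₂, h₃, h₄, rfl, rfl, rfl⟩ := T.exists_eq_diagonalPart H.mul_sub_mul
  obtain ⟨hsq, hcomm⟩ := (T.forall_semiconjBy_diagonalPart_iff.1 H.semiconjBy).1
  obtain ⟨ε, hε, rfl⟩ : ∃ ε : ℝ, (ε = 1 ∨ ε = -1) ∧ h₂ = ε • h₁ := by
    rcases (Commute.mul_self_eq_mul_self_iff hcomm).1 hsq.symm with rfl | rfl
    · exact ⟨1, .inl rfl, (one_smul ℝ h₂).symm⟩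
    · exact ⟨-1, .inr rfl, by rw [neg_one_smul]⟩
  have h0 : h₁ ≠ 0 := by
    rintro rfl
    simp at hQ
  have hsemi := (T.forall_semiconjBy_diagonalPart_smul_iff (mul_self_eq_one_iff.2 hε)).1
    H.semiconjBy
  exact ⟨ε, h₁, h₃, h₄, hε, ⟨h0, hsemi, fun x y =>
    (T.commute_diagonalPart_iff hε h0 hsemi x y).1 (H.commute_right x y)⟩, rfl, rfl, rfl⟩

theorem isDiagonalPair_iff [Nontrivial E] [NoZeroDivisors K] :
    (IsDiagonalPair c a d Q ∧ Q ≠ 0) ↔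
    ∃ (ε : ℝ) (h₁ : K) (h₃ h₄ : E →ₗ[ℝ] K), (ε = 1 ∨ ε = -1) ∧
      (h₁ ≠ 0 ∧ (∀ x, SemiconjBy h₁ (h₃ x + ε • h₄ x) (h₃ x - ε • h₄ x)) ∧
        ∀ x y, Commute (h₃ x + ε • h₄ x) (h₃ y + ε • h₄ y)) ∧
      Q = κ h₁ + κ (ε • h₁) * ω ∧ a = diagonalPart (-c) (-ω) κ h₁ (ε • h₁) h₃ h₄ ∧
      d = diagonalPart c ω κ h₁ (ε • h₁) h₃ h₄ := by
  refine ⟨fun ⟨H, hQ⟩ => T.exists_of_isDiagonalPair H hQ, ?_⟩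
  rintro ⟨ε, h₁, h₃, h₄, hε, ⟨h0, hsemi, hcomm⟩, rfl, rfl, rfl⟩
  exact ⟨T.isDiagonalPair_diagonalPart hε h0 hsemi hcomm,
    fun h => h0 (T.add_mul_omega_eq_zero_iff.1 h).1⟩

end IsCliffordTriple

end DiagonalPart

section Block

variable {S : Type*} [AddCommGroup S] [Module ℝ S] {a b c d a' b' c' d' : Module.End ℝ S}

lemma block_mul : block a b c d * block a' b' c' d' =
    block (a * a' + b * c') (a * b' + b * d') (c * a' + d * c') (c * b' + d * d') := by
  ext <;> simp [block]

lemma block_sub : block a b c d - block a' b' c' d' =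
    block (a - a') (b - b') (c - c') (d - d') := by
  ext <;> simp [block]

lemma smul_block (r : ℝ) : r • block a b c d = block (r • a) (r • b) (r • c) (r • d) := by
  ext <;> simp [block]

lemma block_eq_zero_iff : block a b c d = 0 ↔ a = 0 ∧ b = 0 ∧ c = 0 ∧ d = 0 := by
  simp only [LinearMap.ext_iff, block_apply, LinearMap.zero_apply, Prod.forall, Prod.mk_eq_zero]
  refine ⟨fun h => ⟨fun s => ?_, fun s => ?_, fun s => ?_, fun s => ?_⟩, ?_⟩
  · simpa using (h s 0).1
  · simpa using (h 0 s).1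
  · simpa using (h s 0).2
  · simpa using (h 0 s).2
  · rintro ⟨ha, hb, hc, hd⟩ s t
    simp [ha, hb, hc, hd]

lemma lie_block_upper : ⁅block a b 0 d, block a' b' 0 d'⁆ =
    block ⁅a, a'⁆ (a * b' + b * d' - (a' * b + b' * d)) 0 ⁅d, d'⁆ := by
  simp [Ring.lie_def, block_mul, block_sub]

lemma lie_block_strictly_upper (r : ℝ) : ⁅block 0 (r • b) 0 0, block a' b' c' d'⁆ =
    r • block (b * c') (b * d' - a' * b) 0 (-(c' * b)) := by
  simp [Ring.lie_def, block_mul, block_sub, smul_block, smul_sub]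

lemma exists_eq_block {V : Type*} [AddCommGroup V] [Module ℝ V]
    (f : V →ₗ[ℝ] Module.End ℝ (S × S)) : ∃ a b c d : V →ₗ[ℝ] Module.End ℝ S,
      ∀ x, f x = block (a x) (b x) (c x) (d x) := by
  let entry (i : S →ₗ[ℝ] S × S) (p : S × S →ₗ[ℝ] S) : V →ₗ[ℝ] Module.End ℝ S :=
    LinearMap.llcomp ℝ S (S × S) S p ∘ₗ LinearMap.lcomp ℝ (S × S) i ∘ₗ f
  refine ⟨entry (.inl ℝ S S) (.fst ℝ S S), entry (.inr ℝ S S) (.fst ℝ S S),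
    entry (.inl ℝ S S) (.snd ℝ S S), entry (.inr ℝ S S) (.snd ℝ S S), fun x => ?_⟩
  ext <;> simp [block, entry, Prod.mk_zero_zero]

end Block

section SpinModule

variable {E : Type*} [NormedAddCommGroup E] [InnerProductSpace ℝ E]
  {S : Type*} [AddCommGroup S] [Module ℝ S] [Module (Cl E) S] [IsScalarTower ℝ (Cl E) S]

lemma act_volumeForm {m : ℕ} (e : OrthonormalBasis (Fin m) ℝ E) :
    act S (volumeForm e) = ((List.finRange m).map fun i => cmul S (e i)).prod := by
  rw [volumeForm, List.ofFn_eq_map, map_list_prod, List.map_map]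
  rfl

lemma act_volumeForm_mul_cmul {m : ℕ} (hm : Even m) (e : OrthonormalBasis (Fin m) ℝ E) (x : E) :
    act S (volumeForm e) * cmul S x = -(cmul S x * act S (volumeForm e)) := by
  rw [← e.sum_repr x, map_sum, Finset.sum_mul, Finset.mul_sum, ← Finset.sum_neg_distrib]
  refine Finset.sum_congr rfl fun i _ => ?_
  have h := (isAnticommuting_cmul (S := S) e.orthonormal).mul_prod_of_mem
    (List.nodup_finRange m) (List.mem_finRange i)
  rw [List.length_finRange, hm.neg_one_pow, one_smul, ← act_volumeForm] at h
  rw [map_smul, smul_mul_assoc, mul_smul_comm, h, smul_neg, neg_neg]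

lemma act_volumeForm_mul_self {m : ℕ} (hm : m % 4 = 0) (e : OrthonormalBasis (Fin m) ℝ E) :
    act S (volumeForm e) * act S (volumeForm e) = 1 := by
  have heven : Even (m.choose 2) := by
    obtain ⟨k, rfl⟩ := Nat.dvd_of_mod_eq_zero hm
    rw [Nat.choose_two_right, show 4 * k * (4 * k - 1) = 2 * (2 * (k * (4 * k - 1))) by ring,
      Nat.mul_div_cancel_left _ two_pos]
    exact even_two_mul _
  rw [act_volumeForm, (isAnticommuting_cmul (S := S) e.orthonormal).prod_mul_prod
    (List.nodup_finRange m), List.length_finRange, heven.neg_one_pow, one_smul]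

lemma isCliffordTriple_cmul {m : ℕ} (hm : m % 4 = 0) (e : OrthonormalBasis (Fin m) ℝ E)
    (φ : ℍ[ℝ] ≃ₐ[ℝ] evenSchur E S) :
    IsCliffordTriple (cmul S : E →ₗ[ℝ] _) (act S (volumeForm e)) (quat φ) where
  mul_add_mul := cmul_mul_cmul_add
  omega_mul := act_volumeForm_mul_cmul (Nat.even_iff.2 (by omega)) e
  omega_mul_self := act_volumeForm_mul_self hm e
  mul_map x h := mem_evenSchur.1 (φ h).2 x
  omega_mul_map h := by
    rw [act_volumeForm]
    exact Commute.list_prod_left _ _ fun A hA => by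
      obtain ⟨i, -, rfl⟩ := List.mem_map.1 hA
      exact mem_evenSchur.1 (φ h).2 (e i)
  injective := Subtype.val_injective.comp φ.injective
  exists_of_commute A hA := ⟨φ.symm ⟨A, mem_evenSchur.2 hA⟩, by simp [quat]⟩

section DiagonalPart

variable (φ : ℍ[ℝ] ≃ₐ[ℝ] evenSchur E S) (ω : Module.End ℝ S) (ε : ℝ) (h₁ : ℍ[ℝ])
  (h₃ h₄ : E →ₗ[ℝ] ℍ[ℝ])

lemma quat_mul_one_add_smul : quat φ h₁ * (1 + ε • ω) = quat φ h₁ + quat φ (ε • h₁) * ω := by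
  rw [mul_add, mul_one, map_smul, smul_mul_assoc, mul_smul_comm]

lemma rho₁₁_eq_diagonalPart : rho₁₁ φ ω ε h₁ h₃ h₄ =
    diagonalPart (-cmul S) (-ω) (quat φ) h₁ (ε • h₁) h₃ h₄ := by
  ext1 x
  simp [rho₁₁, diagonalPart_apply, sub_eq_add_neg]

lemma rho₂₂_eq_diagonalPart : rho₂₂ φ ω ε h₁ h₃ h₄ =
    diagonalPart (cmul S) ω (quat φ) h₁ (ε • h₁) h₃ h₄ := by
  ext1 x
  simp [rho₂₂, diagonalPart_apply]

end DiagonalPart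

lemma spinRep_wedge (v : E) : spinRep (E := E) S (wedge ((0, 1, 0) : E × ℝ × ℝ) (v, 0, 0)) =
    block 0 (√2 • cmul S v) 0 0 := by
  have spinRep_ι (w : E × ℝ × ℝ) :
      spinRep (E := E) S (CliffordAlgebra.ι (minkowskiForm E) w) = vecAct S w :=
    CliffordAlgebra.lift_ι_apply _ _ w
  have hp : vecAct S ((0, 1, 0) : E × ℝ × ℝ) = block 0 ((2 * √2) • 1) 0 0 := by
    simp [vecAct]
  have hv : vecAct S ((v, 0, 0) : E × ℝ × ℝ) = block (-cmul S v) 0 0 (cmul S v) := by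
    simp [vecAct]
  rw [wedge, map_smul, Ring.lie_def, map_sub, map_mul, map_mul, spinRep_ι, spinRep_ι, hp, hv,
    ← Ring.lie_def, lie_block_strictly_upper, smul_smul, smul_block]
  simp only [mul_zero, one_mul, mul_one, sub_neg_eq_add, neg_zero, smul_zero]
  congr 1
  module

end SpinModule

section Representation

variable {E : Type*} [NormedAddCommGroup E] [InnerProductSpace ℝ E]
  {S : Type*} [AddCommGroup S] [Module ℝ S] [Module (Cl E) S] [IsScalarTower ℝ (Cl E) S]

lemma exists_ne_zero_inner_eq_zero (hdim : 2 ≤ Module.finrank ℝ E) (y : E) :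
    ∃ z : E, z ≠ 0 ∧ inner ℝ z y = (0 : ℝ) := by
  have : FiniteDimensional ℝ E := .of_finrank_pos (by omega)
  have hker : LinearMap.ker (innerₗ E y) ≠ ⊥ := LinearMap.ker_ne_bot_of_finrank_lt (by
    rw [Module.finrank_self]; omega)
  obtain ⟨z, hz, hz0⟩ := Submodule.exists_mem_ne_zero_of_ne_bot hker
  exact ⟨z, hz0, (real_inner_comm y z).trans hz⟩

lemma eq_zero_of_cmul_mul_eq_zero {z : E} (hz : z ≠ 0) {A : Module.End ℝ S}
    (h : cmul S z * A = 0) : A = 0 := by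
  have hzz : (inner ℝ z z : ℝ) • A = 0 := by
    rw [← one_mul A, ← smul_mul_assoc, ← cmul_mul_self, mul_assoc, h, mul_zero]
  exact (smul_eq_zero.1 hzz).resolve_left (inner_self_ne_zero.2 hz)

variable [FiniteDimensional ℝ E] {b : LinearMap.BilinForm ℝ E}

lemma inner_endB (x y : E) : (inner ℝ (endB b x) y : ℝ) = b x y := by
  rw [endB_spec]
  simp [metric]

lemma endB_surjective (hb : b.Nondegenerate) : Function.Surjective (endB b) := by
  refine LinearMap.injective_iff_surjective.1 ((injective_iff_map_eq_zero _).2 fun x hx => ?_)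
  refine hb.1 x fun y => ?_
  rw [← inner_endB, hx, inner_zero_left]

namespace Heis

lemma exists_eq_add (u : Heis b) :
    ∃ (x y : E) (s : ℝ), u = ofDual b (flat E x) + ofVec b y + s • p b := by
  obtain ⟨α, y, s⟩ := u
  refine ⟨(flat E).symm α, y, s, Prod.ext ?_ (Prod.ext ?_ ?_)⟩
  · change α = flat E ((flat E).symm α) + 0 + s • 0
    simp
  · change y = 0 + y + s • 0
    simp
  · change s = 0 + 0 + s • 1
    simp

lemma lie_flat_flat (x y : E) : ⁅ofDual b (flat E x), ofDual b (flat E y)⁆ = 0 := by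
  have hvec (z : E) : vecPart b (ofDual b (flat E z)) = 0 := rfl
  simp [bracket_def, hvec]

lemma lie_vec_vec (x y : E) : ⁅ofVec b x, ofVec b y⁆ = 0 := by
  have hdual (z : E) : dualPart b (ofVec b z) = 0 := rfl
  simp [bracket_def, hdual]

lemma lie_p (u : Heis b) : ⁅p b, u⁆ = 0 := by
  simp [bracket_def, dualPart_p, vecPart_p]

lemma forall_map_lie_iff {R : Type*} [Ring R] [Algebra ℝ R] {ρ : Heis b →ₗ[ℝ] R} :
    (∀ u v, ρ ⁅u, v⁆ = ⁅ρ u, ρ v⁆) ↔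
      (∀ x y, ⁅ρ (ofDual b (flat E x)), ρ (ofDual b (flat E y))⁆ = 0) ∧
      (∀ x y, ⁅ρ (ofDual b (flat E x)), ρ (ofVec b y)⁆ = b x y • ρ (p b)) ∧
      (∀ x y, ⁅ρ (ofVec b x), ρ (ofVec b y)⁆ = 0) ∧
      (∀ x, ⁅ρ (p b), ρ (ofDual b (flat E x))⁆ = 0) ∧
      ∀ x, ⁅ρ (p b), ρ (ofVec b x)⁆ = 0 := by
  constructor
  · intro h
    simp [← h, lie_flat_flat, flat_lie_vec, lie_vec_vec, lie_p]
  · rintro ⟨hflat, hflat_vec, hvec, hp_flat, hp_vec⟩ u v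
    let _ : LieRing R := .ofAssociativeRing
    let _ : LieAlgebra ℝ R := .ofAssociativeAlgebra
    obtain ⟨x, y, s, rfl⟩ := exists_eq_add u
    obtain ⟨x', y', s', rfl⟩ := exists_eq_add v
    have hvec_flat := lie_skew (ρ (ofVec b y)) (ρ (ofDual b (flat E x')))
    have hflat_p := lie_skew (ρ (ofDual b (flat E x))) (ρ (p b))
    have hvec_p := lie_skew (ρ (ofVec b y)) (ρ (p b))
    have hlie_p (w : Heis b) : ⁅w, p b⁆ = 0 := by rw [← lie_skew, lie_p, neg_zero]
    have hlie_vec_flat : ⁅ofVec b y, ofDual b (flat E x')⁆ = -(b x' y • p b) := by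
      rw [← lie_skew, flat_lie_vec]
    simp only [map_add, map_smul, map_neg, add_lie, lie_add, smul_lie, lie_smul, lie_self,
      lie_flat_flat, flat_lie_vec, lie_vec_vec, lie_p, hlie_p, hlie_vec_flat, ← hvec_flat,
      ← hflat_p, ← hvec_p, hflat, hflat_vec, hvec, hp_flat, hp_vec, smul_zero, neg_zero, add_zero,
      zero_add]

end Heis

variable {ρ : Heis b →ₗ[ℝ] Module.End ℝ (S × S)}

lemma IsSpinRepresentation.exists_upper_triangular (hdim : 2 ≤ Module.finrank ℝ E)
    (hb : b.Nondegenerate) (hρ : IsSpinRepresentation b ρ) :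
    ∃ (a d β : E →ₗ[ℝ] Module.End ℝ S) (Q : Module.End ℝ S),
      ρ (Heis.p b) = √2 • block 0 Q 0 0 ∧ ∀ x, ρ (Heis.ofVec b x) = block (a x) (β x) 0 (d x) := by
  obtain ⟨a, β, γ, d, hvec⟩ := exists_eq_block (ρ ∘ₗ Heis.ofVec b)
  simp only [LinearMap.comp_apply] at hvec
  have hcharge (z y : E) : (inner ℝ z y : ℝ) • ρ (Heis.p b) =
      √2 • block (cmul S z * γ y) (cmul S z * d y - a y * cmul S z) 0 (-(γ y * cmul S z)) := by
    obtain ⟨x, rfl⟩ := endB_surjective hb z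
    rw [inner_endB, ← map_smul, ← Heis.flat_lie_vec, hρ.map_lie, hρ.spin, spinRep_wedge, hvec,
      lie_block_strictly_upper]
  have hγ (y : E) : γ y = 0 := by
    -- `z γ(y)` is the upper left block of a multiple of `⟨z, y⟩ ρ(p)`.
    obtain ⟨z, hz, hzy⟩ := exists_ne_zero_inner_eq_zero hdim y
    have hblock := (hcharge z y).symm.trans (by rw [hzy, zero_smul])
    rw [smul_eq_zero_iff_right (by positivity), block_eq_zero_iff] at hblock
    exact eq_zero_of_cmul_mul_eq_zero hz hblock.1
  have : Nontrivial E := Module.nontrivial_of_finrank_pos (R := ℝ) (by omega)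
  obtain ⟨y, hy⟩ := exists_norm_eq E (zero_le_one' ℝ)
  refine ⟨a, d, β, cmul S y * d y - a y * cmul S y, ?_, fun x => (hvec x).trans (by rw [hγ])⟩
  simpa [hγ, hy] using hcharge y y

lemma forall_map_lie_iff_of_block (hb : b.Nondegenerate) {a d β : E →ₗ[ℝ] Module.End ℝ S}
    {Q : Module.End ℝ S}
    (hspin : ∀ x, ρ (Heis.ofDual b (flat E x)) = block 0 (√2 • cmul S (endB b x)) 0 0)
    (hp : ρ (Heis.p b) = √2 • block 0 Q 0 0)
    (hvec : ∀ x, ρ (Heis.ofVec b x) = block (a x) (β x) 0 (d x)) :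
    (∀ u v, ρ ⁅u, v⁆ = ⁅ρ u, ρ v⁆) ↔ IsSuitable a d β ∧ IsDiagonalPair (cmul S) a d Q := by
  have hs : √2 ≠ 0 := by positivity
  have hflat : ∀ x y, ⁅ρ (Heis.ofDual b (flat E x)), ρ (Heis.ofDual b (flat E y))⁆ = 0 := by
    simp [hspin, lie_block_strictly_upper, block_eq_zero_iff]
  have hflat_vec : (∀ x y, ⁅ρ (Heis.ofDual b (flat E x)), ρ (Heis.ofVec b y)⁆ =
      b x y • ρ (Heis.p b)) ↔
      ∀ z y, cmul S z * d y - a y * cmul S z = (inner ℝ z y : ℝ) • Q := by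
    refine .symm ((endB_surjective hb).forall.trans (forall₂_congr fun x y => .symm ?_))
    rw [hspin, hvec, hp, lie_block_strictly_upper, inner_endB, smul_comm, smul_right_inj hs,
      ← sub_eq_zero, smul_block, block_sub, block_eq_zero_iff]
    simp [sub_eq_zero]
  have hvec_vec : (∀ x y, ⁅ρ (Heis.ofVec b x), ρ (Heis.ofVec b y)⁆ = 0) ↔
      IsSuitable a d β ∧ (∀ x y, Commute (a x) (a y)) ∧ ∀ x y, Commute (d x) (d y) := by
    simp only [hvec, lie_block_upper, block_eq_zero_iff, commute_iff_lie_eq, IsSuitable, true_and,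
      sub_eq_zero, sub_eq_sub_iff_add_eq_add, ← forall_and]
    exact forall₂_congr fun _ _ => and_left_comm
  have hp_flat : ∀ x, ⁅ρ (Heis.p b), ρ (Heis.ofDual b (flat E x))⁆ = 0 := by
    simp [hspin, hp, smul_block, lie_block_strictly_upper, block_eq_zero_iff]
  have hp_vec : (∀ x, ⁅ρ (Heis.p b), ρ (Heis.ofVec b x)⁆ = 0) ↔
      ∀ y, SemiconjBy Q (d y) (a y) := by
    simp [hvec, hp, smul_block, lie_block_strictly_upper, block_eq_zero_iff, SemiconjBy,
      sub_eq_zero]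
  rw [Heis.forall_map_lie_iff, hflat_vec, hvec_vec, hp_vec]
  exact ⟨fun ⟨_, hc, ⟨hs, ha, hd⟩, _, hQ⟩ => ⟨hs, hc, hQ, ha, hd⟩,
    fun ⟨hs, H⟩ => ⟨hflat, H.mul_sub_mul, ⟨hs, H.commute_left, H.commute_right⟩, hp_flat,
      H.semiconjBy⟩⟩

theorem isSpinRepresentation_iff (hdim : 2 ≤ Module.finrank ℝ E) (hb : b.Nondegenerate) :
    IsSpinRepresentation b ρ ↔ ∃ (a d β : E →ₗ[ℝ] Module.End ℝ S) (Q : Module.End ℝ S),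
      (∀ x, ρ (Heis.ofDual b (flat E x)) = block 0 (√2 • cmul S (endB b x)) 0 0) ∧
      ρ (Heis.p b) = √2 • block 0 Q 0 0 ∧
      (∀ x, ρ (Heis.ofVec b x) = block (a x) (β x) 0 (d x)) ∧
      IsSuitable a d β ∧ IsDiagonalPair (cmul S) a d Q := by
  constructor
  · intro hρ
    have hspin (x : E) := (hρ.spin x).trans (spinRep_wedge _)
    obtain ⟨a, d, β, Q, hp, hvec⟩ := hρ.exists_upper_triangular hdim hb
    exact ⟨a, d, β, Q, hspin, hp, hvec,
      (forall_map_lie_iff_of_block hb hspin hp hvec).1 hρ.map_lie⟩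
  · rintro ⟨a, d, β, Q, hspin, hp, hvec, H⟩
    exact ⟨(forall_map_lie_iff_of_block hb hspin hp hvec).2 H,
      fun x => (hspin x).trans (spinRep_wedge _).symm⟩

end Representation

end CahenWallach

theorem theorem2p18_general {E : Type*} [NormedAddCommGroup E] [InnerProductSpace ℝ E]
    [FiniteDimensional ℝ E] (hdim : Module.finrank ℝ E % 8 = 4)
    (e : OrthonormalBasis (Fin (Module.finrank ℝ E)) ℝ E)
    (b : LinearMap.BilinForm ℝ E) (hnondeg : b.Nondegenerate)
    {S : Type*} [AddCommGroup S] [Module ℝ S] [Module (CahenWallach.Cl E) S]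
    [IsScalarTower ℝ (CahenWallach.Cl E) S] [IsSimpleModule (CahenWallach.Cl E) S] :
    Nonempty (ℍ[ℝ] ≃ₐ[ℝ] CahenWallach.evenSchur E S) ∧
    ∀ φ : ℍ[ℝ] ≃ₐ[ℝ] CahenWallach.evenSchur E S,
    ∀ ω : Module.End ℝ S, ω = CahenWallach.act S (CahenWallach.volumeForm e) →
    ∀ ρ : CahenWallach.Heis b →ₗ[ℝ] Module.End ℝ (S × S),
      (CahenWallach.IsSpinRepresentation b ρ ∧ ρ (CahenWallach.Heis.p b) ≠ 0) ↔
      ∃ (ε : ℝ) (h₁ : ℍ[ℝ]) (h₃ h₄ : E →ₗ[ℝ] ℍ[ℝ]) (ρ₁₂ : E →ₗ[ℝ] Module.End ℝ S),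
        (ε = 1 ∨ ε = -1) ∧
        (CahenWallach.FirstCase ε h₁ h₃ h₄ ∨ CahenWallach.SecondCase h₁ h₃ h₄) ∧
        CahenWallach.IsSuitable (CahenWallach.rho₁₁ φ ω ε h₁ h₃ h₄)
          (CahenWallach.rho₂₂ φ ω ε h₁ h₃ h₄) ρ₁₂ ∧
        (∀ x : E, ρ (CahenWallach.Heis.ofDual b (CahenWallach.flat E x)) =
          CahenWallach.block 0
            (√2 • CahenWallach.cmul S (CahenWallach.endB b x)) 0 0) ∧
        ρ (CahenWallach.Heis.p b) =
          √2 • CahenWallach.block 0 (CahenWallach.quat φ h₁ * (1 + ε • ω)) 0 0 ∧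
        ∀ x : E, ρ (CahenWallach.Heis.ofVec b x) =
          CahenWallach.block (CahenWallach.rho₁₁ φ ω ε h₁ h₃ h₄ x) (ρ₁₂ x)
            0 (CahenWallach.rho₂₂ φ ω ε h₁ h₃ h₄ x) := by
  refine ⟨CahenWallach.nonempty_quaternion_algEquiv_evenSchur hdim, ?_⟩
  rintro φ ω rfl ρ
  have : Nontrivial E := Module.nontrivial_of_finrank_pos (R := ℝ) (by omega)
  have T := CahenWallach.isCliffordTriple_cmul (S := S) (by omega) e φ
  have charge_ne_zero {Q : Module.End ℝ S} : √2 • CahenWallach.block 0 Q 0 0 ≠ 0 ↔ Q ≠ 0 := by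
    simp [CahenWallach.block_eq_zero_iff]
  simp only [CahenWallach.isSpinRepresentation_iff (by omega) hnondeg,
    CahenWallach.quat_mul_one_add_smul, CahenWallach.rho₁₁_eq_diagonalPart,
    CahenWallach.rho₂₂_eq_diagonalPart]
  constructor
  · rintro ⟨⟨a, d, β, Q, hspin, hp, hvec, hsuit, H⟩, hp0⟩
    obtain ⟨ε, h₁, h₃, h₄, hε, hcase, rfl, rfl, rfl⟩ :=
      T.isDiagonalPair_iff.1 ⟨H, charge_ne_zero.1 (hp ▸ hp0)⟩
    exact ⟨ε, h₁, h₃, h₄, β, hε,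
      (CahenWallach.firstCase_or_secondCase_iff (mul_self_eq_one_iff.2 hε)).1 hcase,
      hsuit, hspin, hp, hvec⟩
  · rintro ⟨ε, h₁, h₃, h₄, β, hε, hcase, hsuit, hspin, hp, hvec⟩
    obtain ⟨H, hQ⟩ := T.isDiagonalPair_iff.2 ⟨ε, h₁, h₃, h₄, hε,
      (CahenWallach.firstCase_or_secondCase_iff (mul_self_eq_one_iff.2 hε)).2 hcase, rfl, rfl, rfl⟩
    exact ⟨⟨_, _, β, _, hspin, hp, hvec, hsuit, H⟩, hp ▸ charge_ne_zero.2 hQ⟩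

theorem theorem2p18 {E : Type*} [NormedAddCommGroup E] [InnerProductSpace ℝ E]
    [FiniteDimensional ℝ E] (hdim : Module.finrank ℝ E % 8 = 4)
    (e : OrthonormalBasis (Fin (Module.finrank ℝ E)) ℝ E)
    (b : LinearMap.BilinForm ℝ E) (hsymm : b.IsSymm) (hnondeg : b.Nondegenerate)
    {S : Type*} [AddCommGroup S] [Module ℝ S] [Module (CahenWallach.Cl E) S]
    [IsScalarTower ℝ (CahenWallach.Cl E) S] [IsSimpleModule (CahenWallach.Cl E) S] :
    Nonempty (ℍ[ℝ] ≃ₐ[ℝ] CahenWallach.evenSchur E S) ∧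
    ∀ φ : ℍ[ℝ] ≃ₐ[ℝ] CahenWallach.evenSchur E S,
    ∀ ω : Module.End ℝ S, ω = CahenWallach.act S (CahenWallach.volumeForm e) →
    ∀ ρ : CahenWallach.Heis b →ₗ[ℝ] Module.End ℝ (S × S),
      (CahenWallach.IsSpinRepresentation b ρ ∧ ρ (CahenWallach.Heis.p b) ≠ 0) ↔
      ∃ (ε : ℝ) (h₁ : ℍ[ℝ]) (h₃ h₄ : E →ₗ[ℝ] ℍ[ℝ]) (ρ₁₂ : E →ₗ[ℝ] Module.End ℝ S),
        (ε = 1 ∨ ε = -1) ∧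
        (CahenWallach.FirstCase ε h₁ h₃ h₄ ∨ CahenWallach.SecondCase h₁ h₃ h₄) ∧
        CahenWallach.IsSuitable (CahenWallach.rho₁₁ φ ω ε h₁ h₃ h₄)
          (CahenWallach.rho₂₂ φ ω ε h₁ h₃ h₄) ρ₁₂ ∧
        (∀ x : E, ρ (CahenWallach.Heis.ofDual b (CahenWallach.flat E x)) =
          CahenWallach.block 0
            (√2 • CahenWallach.cmul S (CahenWallach.endB b x)) 0 0) ∧
        ρ (CahenWallach.Heis.p b) =
          √2 • CahenWallach.block 0 (CahenWallach.quat φ h₁ * (1 + ε • ω)) 0 0 ∧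
        ∀ x : E, ρ (CahenWallach.Heis.ofVec b x) =
          CahenWallach.block (CahenWallach.rho₁₁ φ ω ε h₁ h₃ h₄ x) (ρ₁₂ x)
            0 (CahenWallach.rho₂₂ φ ω ε h₁ h₃ h₄ x) :=
  theorem2p18_general hdim e b hnondeg
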